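/- Let $g$ be a natural number and let $\Gamma_g(2)\subset \mathrm{Sp}(g,\mathbb Z)$ be the group of integral symplectic matrices $M=\begin{pmatrix}a&b\\c&d\end{pmatrix}$ of size $2g$ with $M\equiv I_{2g} \pmod 2$. Let $\Gamma_g(4,8)$ be the set of those $M\in\mathrm{Sp}(g,\mathbb Z)$ with $M\equiv I_{2g}\pmod 4$ for which the diagonal entries of $a\,{}^tb$ and $c\,{}^td$ are divisible by $8$. Write $e(x)=e^{2\pi i x}$, let $\mathcal H_g$ be the Siegel upper half-space, and put $M\tau=(a\tau+b)(c\tau+d)^{-1}$ for $\tau\in\mathcal H_g$. For $m=\binom{m'}{m''}\in\mathbb Z^{2g}$, $\tau\in\mathcal H_g$ and $z\in\mathbb C^g$ let $$\theta_m(\tau,z)=\sum_{p\in\mathbb Z^g}\exp \pi i\Big[{}^t\big(p+\tfrac{m'}2\big)\tau\big(p+\tfrac{m'}2\big)+2\,{}^t\big(p+\tfrac{m'}2\big)\big(z+\tfrac{m''}2\big)\Big],\qquad \theta_m(\tau)=\theta_m(\tau,0).$$ Write $(s)_0$ for the vector of diagonal entries of a square matrix $s$, and put $$M\circ m=\begin{pmatrix}d&-c\\-b&a\end{pmatrix}\begin{pmatrix}m'\\m''\end{pmatrix}+\begin{pmatrix}(c\,{}^td)_0\\(a\,{}^tb)_0\end{pmatrix},$$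 $$\Phi_m(M)=-\tfrac18\big({}^tm'\,{}^tb d\,m'+{}^tm''\,{}^ta c\,m''-2\,{}^tm'\,{}^tb c\,m''-2\,{}^t(a\,{}^tb)_0(dm'-cm'')\big).$$ Let $a(M)$ be the eighth root of unity, depending on $M$ and on the choice of a continuous branch of $\det(c\tau+d)^{1/2}$ on $\mathcal H_g$, such that $\theta_{M\circ n}(M\tau)=a(M)\,e(\Phi_n(M))\det(c\tau+d)^{1/2}\theta_n(\tau)$ for all $n\in\mathbb Z^{2g}$ and $\tau\in\mathcal H_g$. For $M\in\Gamma_g(2)$ and $m\in\mathbb Z^{2g}$ the number $\chi_m(M)$ is defined by $$\theta_m(M\tau,{}^t(c\tau+d)^{-1}z)=a(M)\,\chi_m(M)\det(c\tau+d)^{1/2}\,e\big(\tfrac12\,{}^tz(c\tau+d)^{-1}c\,z\big)\,\theta_m(\tau,z)\qquad(\tau\in\mathcal H_g,\ z\in\mathbb C^g).$$ If $m$ is even, that is, if ${}^tm'm''$ is even, it is already determined by the case $z=0$, namely $\theta_m(M\tau)=a(M)\chi_m(M)\det(c\tau+d)^{1/2}\theta_m(\tau)$ for all $\tau\in\mathcal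 H_g$. Let $A_{ij}=\begin{pmatrix}\alpha&0\\0&{}^t\alpha^{-1}\end{pmatrix}$ for $1\le i,j\le g$, where $\alpha$ is $I_g$ with its $(i,j)$ entry replaced by $2$ if $i\ne j$ and by $-1$ if $i=j$. For $1\le i\le j\le g$ let $B_{ij}=\begin{pmatrix}I_g&\beta\\0&I_g\end{pmatrix}$, where $\beta$ is the zero matrix with its $(i,j)$ and $(j,i)$ entries replaced by $2$, and let $C_{ij}={}^tB_{ij}$. **Theorem.** The commutator subgroup of $\Gamma_g(2)$ is contained in $\Gamma_g(4,8)$. Fix any orders of the factors in the three products below. Every $M\in\Gamma_g(2)$ can be written as $$M=\prod_{1\le i,j\le g}A_{ij}^{p_{ij}}\prod_{1\le i\le j\le g}B_{ij}^{q_{ij}}\prod_{1\le i\le j\le g}C_{ij}^{r_{ij}}\;M'$$ with $p_{ij},q_{ij},r_{ij}\in\mathbb Z$ and $M'$ in the commutator subgroup of $\Gamma_g(2)$. Whenever $M$ is written in this way, for every $m\in\mathbb Z^{2g}$ the number $\chi_m(M)$ exists, is unique, and equals $$\chi_m(M)=(-1)^{A}\,e\big(-\tfrac B4\big),$$ where $$A=\sum_{1\le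 i,j\le g}p_{ij}m'_im''_j+\sum_{1\le i\le j\le g}q_{ij}m'_im'_j+\sum_{1\le i<j\le g}r_{ij}m''_im''_j,\qquad B=\sum_{i=1}^g q_{ii}(m'_i)^2+\sum_{i=1}^g r_{ii}(m''_i)^2.$$ -/

import Mathlib

open Matrix

noncomputable section

namespace SiegelTheta

/-- `e(x) = exp(2πix)`. -/
def e (x : ℂ) : ℂ := Complex.exp (2 * Real.pi * Complex.I * x)

/-- The Siegel modular group `Sp(g, ℤ)`. -/
abbrev Sp (g : ℕ) : Type := symplecticGroup (Fin g) ℤ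

/-- A theta characteristic `m`, with `m' = m ∘ Sum.inl` and `m'' = m ∘ Sum.inr`. -/
abbrev Characteristic (g : ℕ) : Type := Fin g ⊕ Fin g → ℤ

section Blocks

variable {g : ℕ}

/-- The blocks of `M = (a, b; c, d)`. -/
def blkA (M : Sp g) : Matrix (Fin g) (Fin g) ℤ := M.1.toBlocks₁₁

def blkB (M : Sp g) : Matrix (Fin g) (Fin g) ℤ := M.1.toBlocks₁₂

def blkC (M : Sp g) : Matrix (Fin g) (Fin g) ℤ := M.1.toBlocks₂₁

def blkD (M : Sp g) : Matrix (Fin g) (Fin g) ℤ := M.1.toBlocks₂₂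

/-- An integral matrix regarded as a complex matrix. -/
def toC (X : Matrix (Fin g) (Fin g) ℤ) : Matrix (Fin g) (Fin g) ℂ := X.map (fun x => (x : ℂ))

end Blocks

/-! ### Congruence subgroups -/

/-- `Γ_g(2)`: the matrices in `Sp(g, ℤ)` congruent to the identity modulo `2`. -/
def Gamma2 (g : ℕ) : Subgroup (Sp g) where
  carrier := {M | M.1.map (Int.castRingHom (ZMod 2)) = 1}
  one_mem' := by simp
  mul_mem' := by
    intro M N hM hN
    simp only [Set.mem_ofPred_eq] at hM hN ⊢
    rw [Submonoid.coe_mul, Matrix.map_mul, hM, hN, mul_one]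
  inv_mem' := by
    intro M hM
    simp only [Set.mem_ofPred_eq] at hM ⊢
    have h : (M.1 * (M⁻¹).1).map (Int.castRingHom (ZMod 2)) = 1 := by
      rw [← Submonoid.coe_mul, mul_inv_cancel]
      simp
    rw [Matrix.map_mul, hM, one_mul] at h
    exact h

/-- `Γ_g(4,8)`: `M ≡ 1 mod 4`, and the diagonals of `a ᵗb` and `c ᵗd` vanish modulo `8`. -/
def Gamma48 (g : ℕ) : Set (Sp g) :=
  {M | M.1.map (Int.castRingHom (ZMod 4)) = 1 ∧
    (∀ i, (8 : ℤ) ∣ (blkA M * (blkB M)ᵀ) i i) ∧ ∀ i, (8 : ℤ) ∣ (blkC M * (blkD M)ᵀ) i i}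

/-! ### Theta functions and their transformation -/

/-- The Siegel upper half-space of degree `g`. -/
def SiegelUpperHalf (g : ℕ) : Set (Matrix (Fin g) (Fin g) ℂ) :=
  {τ | τᵀ = τ ∧ (τ.map Complex.im).PosDef}

section Theta

variable {g : ℕ}

/-- The theta function `θ_m(τ, z)`. -/
def theta (m : Characteristic g) (τ : Matrix (Fin g) (Fin g) ℂ) (z : Fin g → ℂ) : ℂ :=
  ∑' p : Fin g → ℤ,
    let v : Fin g → ℂ := fun i => (p i : ℂ) + (m (Sum.inl i) : ℂ) / 2
    Complex.exp (Real.pi * Complex.I *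
      (v ⬝ᵥ (τ *ᵥ v) + 2 * (v ⬝ᵥ fun i => z i + (m (Sum.inr i) : ℂ) / 2)))

/-- The theta constant `θ_m(τ) = θ_m(τ, 0)`. -/
def thetaConst (m : Characteristic g) (τ : Matrix (Fin g) (Fin g) ℂ) : ℂ := theta m τ 0

/-- `cτ + d`. -/
def autFactor (M : Sp g) (τ : Matrix (Fin g) (Fin g) ℂ) : Matrix (Fin g) (Fin g) ℂ :=
  toC (blkC M) * τ + toC (blkD M)

/-- `Mτ = (aτ + b)(cτ + d)⁻¹`. -/
def act (M : Sp g) (τ : Matrix (Fin g) (Fin g) ℂ) : Matrix (Fin g) (Fin g) ℂ :=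
  (toC (blkA M) * τ + toC (blkB M)) * (autFactor M τ)⁻¹

/-- The operation `M ∘ m` on characteristics. -/
def charAct (M : Sp g) (m : Characteristic g) : Characteristic g :=
  Sum.elim
    (blkD M *ᵥ (m ∘ Sum.inl) - blkC M *ᵥ (m ∘ Sum.inr) + (blkC M * (blkD M)ᵀ).diag)
    (-(blkB M *ᵥ (m ∘ Sum.inl)) + blkA M *ᵥ (m ∘ Sum.inr) + (blkA M * (blkB M)ᵀ).diag)

/-- `Φ_m(M)`. -/
def Phi (m : Characteristic g) (M : Sp g) : ℂ :=
  let m₁ : Fin g → ℤ := m ∘ Sum.inl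
  let m₂ : Fin g → ℤ := m ∘ Sum.inr
  let N : ℤ := m₁ ⬝ᵥ (((blkB M)ᵀ * blkD M) *ᵥ m₁) + m₂ ⬝ᵥ (((blkA M)ᵀ * blkC M) *ᵥ m₂)
    - 2 * (m₁ ⬝ᵥ (((blkB M)ᵀ * blkC M) *ᵥ m₂))
    - 2 * ((blkA M * (blkB M)ᵀ).diag ⬝ᵥ (blkD M *ᵥ m₁ - blkC M *ᵥ m₂))
  (-1 / 8 : ℂ) * (N : ℂ)

/-- `a` is the constant `a(M)` that belongs to the branch `s` of `det(cτ + d)^{1/2}`: an eighth root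
of unity for which the transformation formula
`θ_{M∘n}(Mτ) = a(M) e(Φ_n(M)) det(cτ + d)^{1/2} θ_n(τ)` of theta constants holds for every
characteristic `n`. -/
structure IsThetaMultiplier (M : Sp g) (a : ℂ) (s : Matrix (Fin g) (Fin g) ℂ → ℂ) : Prop where
  root_of_unity : a ^ 8 = 1
  continuousOn : ContinuousOn s (SiegelUpperHalf g)
  sq_eq : ∀ τ ∈ SiegelUpperHalf g, s τ ^ 2 = (autFactor M τ).det
  transform : ∀ n : Characteristic g, ∀ τ ∈ SiegelUpperHalf g,
    thetaConst (charAct M n) (act M τ) = a * e (Phi n M) * s τ * thetaConst n τ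

/-- `χ` is a value of `χ_m(M)` as defined by theta constants:
`θ_m(Mτ) = a(M) χ_m(M) det(cτ + d)^{1/2} θ_m(τ)`. This pins `χ` down only for even `m`, since
`θ_m(τ)` vanishes identically for odd `m`. -/
def IsConstCharValue (m : Characteristic g) (M : Sp g) (χ : ℂ) : Prop :=
  ∃ (a : ℂ) (s : Matrix (Fin g) (Fin g) ℂ → ℂ), IsThetaMultiplier M a s ∧
    ∀ τ ∈ SiegelUpperHalf g, thetaConst m (act M τ) = a * χ * s τ * thetaConst m τ

/-- `χ` is a value of `χ_m(M)` as defined by theta functions: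
`θ_m(Mτ, ᵗ(cτ + d)⁻¹ z) =
  a(M) χ_m(M) det(cτ + d)^{1/2} e(½ ᵗz (cτ + d)⁻¹ c z) θ_m(τ, z)`,
with the same `a(M)`. At `z = 0` this is the relation between theta constants; it determines `χ`
for odd `m` also. -/
def IsCharValue (m : Characteristic g) (M : Sp g) (χ : ℂ) : Prop :=
  ∃ (a : ℂ) (s : Matrix (Fin g) (Fin g) ℂ → ℂ), IsThetaMultiplier M a s ∧
    ∀ τ ∈ SiegelUpperHalf g, ∀ z : Fin g → ℂ,
      theta m (act M τ) (((autFactor M τ)⁻¹)ᵀ *ᵥ z) =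
        a * χ * s τ * e (1 / 2 * (z ⬝ᵥ (((autFactor M τ)⁻¹ * toC (blkC M)) *ᵥ z))) * theta m τ z

/-- A characteristic is even if `ᵗm' m''` is even. -/
def IsEvenChar (m : Characteristic g) : Prop := Even ((m ∘ Sum.inl) ⬝ᵥ (m ∘ Sum.inr))

end Theta

/-! ### Igusa's generators -/

section Generators

variable {g : ℕ}

/-- The identity matrix with its `(i, j)` entry replaced by `2` if `i ≠ j` and by `-1` if
`i = j`. -/
def genA (i j : Fin g) : Matrix (Fin g) (Fin g) ℤ :=
  Matrix.of fun k l => if k = i ∧ l = j then (if i = j then -1 else 2) else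
    (1 : Matrix (Fin g) (Fin g) ℤ) k l

/-- The zero matrix with its `(i, j)` and `(j, i)` entries replaced by `2`. -/
def genB (i j : Fin g) : Matrix (Fin g) (Fin g) ℤ :=
  Matrix.of fun k l => if (k = i ∧ l = j) ∨ (k = j ∧ l = i) then 2 else 0

theorem isUnit_det_genA (i j : Fin g) : IsUnit (genA i j).det := by
  by_cases h : i = j
  · subst h
    have : genA i i = Matrix.diagonal (fun k => if k = i then (-1 : ℤ) else 1) := by
      ext k l
      by_cases hk : k = i <;> by_cases hl : l = i <;> by_cases hkl : k = l <;>
        simp_all [genA, Matrix.one_apply]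
    rw [this, Matrix.det_diagonal]
    simp
  · have : genA i j = Matrix.transvection i j 2 := by
      ext k l
      by_cases hk : k = i <;> by_cases hl : l = j <;>
        simp_all [genA, Matrix.transvection, Matrix.one_apply, eq_comm]
    rw [this, Matrix.det_transvection_of_ne i j h]
    exact isUnit_one

theorem genB_transpose (i j : Fin g) : (genB i j)ᵀ = genB i j := by
  ext k l
  simp only [genB, Matrix.transpose_apply, Matrix.of_apply]
  congr 1
  apply propext
  tauto

/-- `A_{ij} = (a, 0; 0, ᵗa⁻¹)`. -/
def A (i j : Fin g) : Sp g :=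
  ⟨Matrix.fromBlocks (genA i j) 0 0 (((genA i j)⁻¹)ᵀ), by
    have h := Matrix.mul_nonsing_inv _ (isUnit_det_genA i j)
    have h2 : ((genA i j)⁻¹)ᵀ * (genA i j)ᵀ = 1 := by
      rw [← Matrix.transpose_mul, h, Matrix.transpose_one]
    rw [SymplecticGroup.mem_iff, Matrix.J, Matrix.fromBlocks_multiply,
      Matrix.fromBlocks_transpose, Matrix.fromBlocks_multiply]
    simp [h, h2]⟩

/-- `B_{ij} = (1, b; 0, 1)`. -/
def B (i j : Fin g) : Sp g :=
  ⟨Matrix.fromBlocks 1 (genB i j) 0 1, by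
    rw [SymplecticGroup.mem_iff, Matrix.J, Matrix.fromBlocks_multiply,
      Matrix.fromBlocks_transpose, Matrix.fromBlocks_multiply]
    simp [genB_transpose]⟩

/-- `C_{ij} = ᵗB_{ij}`. -/
def C (i j : Fin g) : Sp g :=
  ⟨(B i j).1ᵀ, SymplecticGroup.transpose_mem (B i j).2⟩

/-- `l` lists every pair `(i, j)` with `P i j` exactly once. -/
def Enumerates (l : List (Fin g × Fin g)) (P : Fin g → Fin g → Prop) : Prop :=
  l.Nodup ∧ ∀ x : Fin g × Fin g, x ∈ l ↔ P x.1 x.2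

/-- The ordered product `∏ X_{ij}^{k_{ij}}` along the list `l`. -/
def orderedProd (l : List (Fin g × Fin g)) (X : Fin g → Fin g → Sp g)
    (k : Fin g → Fin g → ℤ) : Sp g :=
  (l.map fun x => X x.1 x.2 ^ k x.1 x.2).prod

/-- The exponent `A` of `-1`. -/
def expA (p q r : Fin g → Fin g → ℤ) (m : Characteristic g) : ℤ :=
  (∑ i, ∑ j, p i j * m (Sum.inl i) * m (Sum.inr j))
    + (∑ i, ∑ j, if i ≤ j then q i j * m (Sum.inl i) * m (Sum.inl j) else 0)
    + ∑ i, ∑ j, if i < j then r i j * m (Sum.inr i) * m (Sum.inr j) else 0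

/-- The exponent `B`. -/
def expB (q r : Fin g → Fin g → ℤ) (m : Characteristic g) : ℤ :=
  (∑ i, q i i * m (Sum.inl i) ^ 2) + ∑ i, r i i * m (Sum.inr i) ^ 2

end Generators

end SiegelTheta

end

noncomputable section

namespace SiegelTheta

/-! ### The symplectic form and the quadratic character of `Γ_g(2)` -/

section Arithmetic

variable {g : ℕ}

/-! Everything is reduced to the theta function of characteristic zero. Suppose that under `M` it
acquires a factor κ(τ) e(½ ᵗz(cτ+d)⁻¹cz). Translating `z` by half periods then carries the law to
every characteristic: θ_m at Mτ becomes θ_n at τ with n = ᵗMm, the same κ, and the constant exp(πi/4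
(ᵗm'm'' - ᵗn'n'')) (`IsThetaFactor.theta`). For `M` in Γ_g(2) one has n = m + 2k, so θ_n = ±θ_m, and
the total constant is i to the power ⟨m,k⟩ - 2 ᵗk'k'', which is `chiExp`
(`IsThetaFactor.theta_of_mem_Gamma2`). The same law applied to M∘n identifies κ with a(M)
det(cτ+d)^{1/2} (`IsThetaFactor.thetaConst_charAct`, `IsThetaMultiplier.mul_eq`), so that power of i
is χ_m(M).

Invariance of the symplectic form makes `chiExp m` modulo 4 a homomorphism on Γ_g(2) (`chiExp_mul`).
Hence it kills commutators, and its value on an ordered product depends only on the exponents, not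
on the order. Together with the homomorphism 1 + 2X ↦ X mod 2, its vanishing on commutators gives
the inclusion in Γ_g(4,8).

Two facts remain. The elements A_ij, B_ij, C_ij generate Γ_g(2) (`genGroup_eq`), by a Euclidean
algorithm whose row operations add even multiples. And κ exists on these generators
(`Gamma2_le_thetaGroup`): for A_ij and B_ij by inspecting the series, for C_ii by Jacobi's
one-variable inversion formula, for C_ij by conjugation. Uniqueness of χ_m(M) rests on nonvanishing:
at a suitable τ an even theta constant is a sum of positive terms. -/

/-- The standard symplectic form on characteristics. -/
def symp (u v : Characteristic g) : ℤ :=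
  (u ∘ Sum.inl) ⬝ᵥ (v ∘ Sum.inr) - (u ∘ Sum.inr) ⬝ᵥ (v ∘ Sum.inl)

/-- The quadratic form `ᵗm' m''` on characteristics. -/
def quad (u : Characteristic g) : ℤ := (u ∘ Sum.inl) ⬝ᵥ (u ∘ Sum.inr)

theorem symp_eq_J (u v : Characteristic g) : symp u v = -(u ⬝ᵥ (J (Fin g) ℤ *ᵥ v)) := by
  simp [symp, J, dotProduct, Fintype.sum_sum_type, fromBlocks_mulVec, neg_mulVec]
  ring

theorem symp_add_left (u v w : Characteristic g) : symp (u + v) w = symp u w + symp v w := by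
  simp only [symp_eq_J, add_dotProduct]; ring

theorem symp_add_right (u v w : Characteristic g) : symp u (v + w) = symp u v + symp u w := by
  simp only [symp_eq_J, mulVec_add, dotProduct_add]; ring

theorem symp_smul_left (k : ℤ) (u v : Characteristic g) : symp (k • u) v = k * symp u v := by
  simp only [symp_eq_J, smul_dotProduct, smul_eq_mul]; ring

theorem symp_smul_right (k : ℤ) (u v : Characteristic g) : symp u (k • v) = k * symp u v := by
  simp only [symp_eq_J, mulVec_smul, dotProduct_smul, smul_eq_mul]; ring

theorem quad_add (u v : Characteristic g) :
    quad (u + v) = quad u + quad v + symp u v + 2 * ((u ∘ Sum.inr) ⬝ᵥ (v ∘ Sum.inl)) := by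
  have h : ∀ s : Fin g → Fin g ⊕ Fin g, (u + v) ∘ s = u ∘ s + v ∘ s := fun s => rfl
  simp only [quad, symp, h, add_dotProduct, dotProduct_add]
  rw [dotProduct_comm (v ∘ Sum.inl) (u ∘ Sum.inr)]
  ring

theorem quad_smul (k : ℤ) (u : Characteristic g) : quad (k • u) = k ^ 2 * quad u := by
  have h : ∀ s : Fin g → Fin g ⊕ Fin g, (k • u) ∘ s = k • (u ∘ s) := fun s => rfl
  simp only [quad, h, smul_dotProduct, dotProduct_smul, smul_eq_mul]
  ring

theorem symp_transpose_mulVec (M : Sp g) (u v : Characteristic g) :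
    symp (M.1ᵀ *ᵥ u) (M.1ᵀ *ᵥ v) = symp u v := by
  have h := SymplecticGroup.mem_iff.1 M.2
  rw [symp_eq_J, symp_eq_J, mulVec_transpose, ← dotProduct_mulVec, mulVec_mulVec,
    mulVec_mulVec, h]

theorem symp_mulVec (M : Sp g) (u v : Characteristic g) :
    symp (M.1 *ᵥ u) (M.1 *ᵥ v) = symp u v := by
  have h := symp_transpose_mulVec ⟨M.1ᵀ, SymplecticGroup.transpose_mem M.2⟩ u v
  simpa using h

theorem exists_eq_one_add_two_smul {M : Sp g} (hM : M ∈ Gamma2 g) :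
    ∃ X : Matrix (Fin g ⊕ Fin g) (Fin g ⊕ Fin g) ℤ, M.1 = 1 + (2 : ℤ) • X := by
  have h : ∀ i j, (2 : ℤ) ∣ M.1 i j - (1 : Matrix (Fin g ⊕ Fin g) (Fin g ⊕ Fin g) ℤ) i j := by
    intro i j
    have h1 := congrFun (congrFun hM i) j
    apply (ZMod.intCast_zmod_eq_zero_iff_dvd _ 2).1
    have h1 : ((M.1 i j : ℤ) : ZMod 2) = (1 : Matrix (Fin g ⊕ Fin g) (Fin g ⊕ Fin g) (ZMod 2)) i j :=
      h1
    rw [Int.cast_sub, h1]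
    by_cases hij : i = j <;> simp [one_apply, hij]
  choose X hX using h
  refine ⟨of X, ?_⟩
  ext i j
  have := hX i j
  simp only [Matrix.add_apply, Matrix.smul_apply, of_apply, smul_eq_mul]
  lia

theorem mem_Gamma2_of_eq {M : Sp g} (X : Matrix (Fin g ⊕ Fin g) (Fin g ⊕ Fin g) ℤ)
    (h : M.1 = 1 + (2 : ℤ) • X) : M ∈ Gamma2 g := by
  change M.1.map (Int.castRingHom (ZMod 2)) = 1
  ext i j
  have h2 : (2 : ZMod 2) = 0 := rfl
  by_cases hij : i = j <;> simp [h, one_apply, hij, h2, -zsmul_eq_mul]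

/-- Half of `ᵗM m - m`. -/
def halfDiff (M : Sp g) (m : Characteristic g) : Characteristic g :=
  fun x => (M.1ᵀ *ᵥ m - m) x / 2

/-- The integer division in `halfDiff` is exact here, since `ᵗM - 1` is `2 ᵗX`. -/
theorem halfDiff_eq {M : Sp g} {X : Matrix (Fin g ⊕ Fin g) (Fin g ⊕ Fin g) ℤ}
    (h : M.1 = 1 + (2 : ℤ) • X) (m : Characteristic g) : halfDiff M m = Xᵀ *ᵥ m := by
  ext x
  simp [halfDiff, h, add_mulVec, smul_mulVec, -zsmul_eq_mul]

theorem transpose_mulVec_eq {M : Sp g} (hM : M ∈ Gamma2 g) (m : Characteristic g) :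
    M.1ᵀ *ᵥ m = m + (2 : ℤ) • halfDiff M m := by
  obtain ⟨X, hX⟩ := exists_eq_one_add_two_smul hM
  rw [halfDiff_eq hX, hX]
  simp [add_mulVec, smul_mulVec, -zsmul_eq_mul]

/-- The exponent of `i` in `χ_m(M)`. -/
def chiExp (m : Characteristic g) (M : Sp g) : ℤ :=
  symp m (halfDiff M m) - 2 * quad (halfDiff M m)

/-- Divided by 4, the right side is the phase met in the theta transformation: the difference of
`quad` comes from passing from `m` to `ᵗM m`, the last term from reducing `ᵗM m` to `m` again. -/
theorem chiExp_eq {M : Sp g} (hM : M ∈ Gamma2 g) (m : Characteristic g) :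
    2 * chiExp m M = quad m - quad (M.1ᵀ *ᵥ m)
      + 4 * ((m ∘ Sum.inl) ⬝ᵥ (halfDiff M m ∘ Sum.inr)) := by
  rw [transpose_mulVec_eq hM, quad_add, quad_smul, symp_smul_right, chiExp]
  have h : ((2 : ℤ) • halfDiff M m) ∘ (Sum.inl : Fin g → _)
    = (2 : ℤ) • (halfDiff M m ∘ Sum.inl) := rfl
  rw [h, dotProduct_smul, smul_eq_mul, symp]
  ring

theorem chiExp_mul (m : Characteristic g) {M N : Sp g} (hM : M ∈ Gamma2 g) (hN : N ∈ Gamma2 g) :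
    (chiExp m (M * N) : ZMod 4) = chiExp m M + chiExp m N := by
  obtain ⟨X, hX⟩ := exists_eq_one_add_two_smul hM
  obtain ⟨Y, hY⟩ := exists_eq_one_add_two_smul hN
  have hXY : (M * N).1 = 1 + (2 : ℤ) • (X + Y + (2 : ℤ) • (X * Y)) := by
    rw [Submonoid.coe_mul, hX, hY]
    simp only [mul_add, add_mul, mul_one, one_mul, smul_mul_smul_comm, smul_add, smul_smul]
    abel
  have hk : halfDiff (M * N) m
      = halfDiff M m + (halfDiff N m + (2 : ℤ) • (Yᵀ *ᵥ halfDiff M m)) := by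
    rw [halfDiff_eq hX, halfDiff_eq hY, halfDiff_eq hXY]
    simp [add_mulVec, smul_mulVec, add_assoc, -zsmul_eq_mul]
  -- The cross terms in `chiExp m (M * N)` amount modulo 4 to `2 * x3 - 2 * x4`; invariance of the
  -- form under `ᵗN` says that `x3 - x4` is even.
  have hinv := symp_transpose_mulVec N m (halfDiff M m)
  rw [transpose_mulVec_eq hN, transpose_mulVec_eq hN, halfDiff_eq hY (halfDiff M m)] at hinv
  simp only [symp_add_left, symp_add_right, symp_smul_left, symp_smul_right] at hinv
  have hskew : symp (halfDiff N m) (halfDiff M m) = -symp (halfDiff M m) (halfDiff N m) := by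
    simp only [symp]
    rw [dotProduct_comm (halfDiff N m ∘ Sum.inl), dotProduct_comm (halfDiff N m ∘ Sum.inr)]
    ring
  rw [hskew] at hinv
  rw [← Int.cast_add, ZMod.intCast_eq_intCast_iff_dvd_sub, chiExp, chiExp, chiExp, hk]
  simp only [quad_add, quad_smul, symp_add_right, symp_smul_right]
  generalize symp m (halfDiff M m) = x1 at *
  generalize symp m (halfDiff N m) = x2 at *
  generalize symp m (Yᵀ *ᵥ halfDiff M m) = x3 at *
  generalize symp (halfDiff M m) (halfDiff N m) = x4 at *
  generalize symp (halfDiff N m) (Yᵀ *ᵥ halfDiff M m) = x5 at *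
  generalize symp (halfDiff M m) (Yᵀ *ᵥ halfDiff M m) = x6 at *
  have hc : ∀ u : Characteristic g, ((2 : ℤ) • u) ∘ (Sum.inl : Fin g → _)
    = (2 : ℤ) • (u ∘ Sum.inl) := fun _ => rfl
  simp only [hc, dotProduct_smul, smul_eq_mul]
  push_cast
  lia

theorem chiExp_one (m : Characteristic g) : chiExp m 1 = 0 := by
  have h : (1 : Sp g).1 = 1 + (2 : ℤ) • 0 := by simp
  rw [chiExp, halfDiff_eq h]
  simp [symp, quad, dotProduct]

/-- The character `M ↦ chiExp m M mod 4` of `Γ_g(2)`. -/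
def chiHom (m : Characteristic g) : Gamma2 g →* Multiplicative (ZMod 4) where
  toFun M := Multiplicative.ofAdd (chiExp m M.1 : ZMod 4)
  map_one' := by simp [chiExp_one]
  map_mul' M N := by
    rw [← ofAdd_add, ← chiExp_mul m M.2 N.2]; rfl

/-- The homomorphism `1 + 2X ↦ X mod 2` on `Γ_g(2)`. -/
def halfHom (x : Characteristic g) (y : Fin g ⊕ Fin g) : Gamma2 g →* Multiplicative (ZMod 2) where
  toFun M := Multiplicative.ofAdd (halfDiff M.1 x y : ZMod 2)
  map_one' := by
    have h : (1 : Sp g).1 = 1 + (2 : ℤ) • 0 := by simp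
    simp [halfDiff_eq h]
  map_mul' M N := by
    obtain ⟨X, hX⟩ := exists_eq_one_add_two_smul M.2
    obtain ⟨Y, hY⟩ := exists_eq_one_add_two_smul N.2
    have hXY : (M * N).1.1 = 1 + (2 : ℤ) • (X + Y + (2 : ℤ) • (X * Y)) := by
      rw [Subgroup.coe_mul, Submonoid.coe_mul, hX, hY]
      simp only [mul_add, add_mul, mul_one, one_mul, smul_mul_smul_comm, smul_add, smul_smul]
      abel
    have h2 : (2 : ZMod 2) = 0 := rfl
    rw [← ofAdd_add, halfDiff_eq hX, halfDiff_eq hY, halfDiff_eq hXY]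
    simp [add_mulVec, smul_mulVec, h2, -zsmul_eq_mul]

theorem map_eq_one_of_mem_commutator {α : Type*} [CommGroup α] (f : Gamma2 g →* α) {M : Sp g}
    (hM : M ∈ Gamma2 g) (h : M ∈ ⁅Gamma2 g, Gamma2 g⁆) : f ⟨M, hM⟩ = 1 := by
  rw [← Subgroup.map_subtype_commutator] at h
  obtain ⟨M', hM', rfl⟩ := h
  exact (Abelianization.commutator_subset_ker f) hM'

theorem mem_Gamma2_of_mem_commutator {M : Sp g} (h : M ∈ ⁅Gamma2 g, Gamma2 g⁆) : M ∈ Gamma2 g := by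
  rw [← Subgroup.map_subtype_commutator] at h
  obtain ⟨M', hM', rfl⟩ := h
  exact M'.2

/-- The matrix homomorphism `halfHom` gives congruence to 1 modulo 4; the finer condition modulo 8
on the diagonals comes from `chiHom`. -/
theorem commutator_subset_Gamma48 {M : Sp g} (h : M ∈ ⁅Gamma2 g, Gamma2 g⁆) : M ∈ Gamma48 g := by
  have hM := mem_Gamma2_of_mem_commutator h
  obtain ⟨X, hX⟩ := exists_eq_one_add_two_smul hM
  have hX2 : ∀ i j, (2 : ℤ) ∣ X i j := by
    intro i j
    have h1 := map_eq_one_of_mem_commutator (halfHom (Pi.single i 1) j) hM h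
    have h1 : (halfDiff M (Pi.single i 1) j : ZMod 2) = 0 := h1
    rw [halfDiff_eq hX] at h1
    have := (ZMod.intCast_zmod_eq_zero_iff_dvd _ 2).1 h1
    simpa using this
  choose Z hZ using hX2
  have hMZ : M.1 = 1 + (4 : ℤ) • of Z := by
    rw [hX]; ext i j
    simp [hZ, -zsmul_eq_mul]; ring
  have hchi : ∀ m, (4 : ℤ) ∣ chiExp m M := by
    intro m
    have h1 := map_eq_one_of_mem_commutator (chiHom m) hM h
    have h1 : (chiExp m M : ZMod 4) = 0 := h1
    exact (ZMod.intCast_zmod_eq_zero_iff_dvd _ 4).1 h1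
  have hX' : X = (2 : ℤ) • of Z := by ext i j; simp [hZ, -zsmul_eq_mul]
  -- For `X = 2Z` the quadratic term of `chiExp` is divisible by 8, so only twice the symplectic
  -- term matters modulo 4.
  have hdiag : ∀ m : Characteristic g, (2 : ℤ) ∣ symp m ((of Z)ᵀ *ᵥ m) := by
    intro m
    have := hchi m
    rw [chiExp, halfDiff_eq hX, hX', transpose_smul, smul_mulVec, quad_smul, symp_smul_right]
      at this
    lia
  refine ⟨?_, ?_, ?_⟩
  · ext i j
    have h4 : (4 : ZMod 4) = 0 := rfl
    by_cases hij : i = j <;> simp [hMZ, one_apply, hij, h4, -zsmul_eq_mul]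
  · intro i
    -- At a unit vector the form isolates one diagonal entry of an off-diagonal block of `Z`. In the
    -- diagonal of `a ᵗb` that entry appears with coefficient 4, and all other contributions carry a
    -- factor 16.
    have h1 : (2 : ℤ) ∣ Z (Sum.inl i) (Sum.inr i) := by
      have := hdiag (Pi.single (Sum.inl i) 1)
      simpa [symp, dotProduct, mulVec_single, Pi.single_apply] using this
    obtain ⟨w, hw⟩ := h1
    simp only [mul_apply, blkA, blkB, toBlocks₁₁, toBlocks₁₂, transpose_apply, of_apply, hMZ,
      Matrix.add_apply, Matrix.smul_apply, smul_eq_mul, one_apply, Sum.inl.injEq, reduceCtorEq, if_false,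
      zero_add, add_mul, ite_mul, one_mul, zero_mul, Finset.sum_add_distrib, Finset.sum_ite_eq,
      Finset.mem_univ, if_true]
    refine dvd_add ⟨w, by rw [hw]; ring⟩ (Finset.dvd_sum fun k _ => ⟨2 * Z (Sum.inl i) (Sum.inl k) *
      Z (Sum.inl i) (Sum.inr k), by ring⟩)
  · intro i
    have h1 : (2 : ℤ) ∣ Z (Sum.inr i) (Sum.inl i) := by
      have := hdiag (Pi.single (Sum.inr i) 1)
      simpa [symp, dotProduct, mulVec_single, Pi.single_apply] using this
    obtain ⟨w, hw⟩ := h1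
    simp only [mul_apply, blkC, blkD, toBlocks₂₁, toBlocks₂₂, transpose_apply, of_apply, hMZ,
      Matrix.add_apply, Matrix.smul_apply, smul_eq_mul, one_apply, Sum.inr.injEq, reduceCtorEq, if_false,
      zero_add, mul_add, mul_ite, mul_one, mul_zero, Finset.sum_add_distrib, Finset.sum_ite_eq,
      Finset.mem_univ, if_true]
    refine dvd_add ⟨w, by rw [hw]; ring⟩ (Finset.dvd_sum fun k _ => ⟨2 * Z (Sum.inr i) (Sum.inl k) *
      Z (Sum.inr i) (Sum.inr k), by ring⟩)

end Arithmetic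

/-! ### Generation of `Γ_g(2)` -/

section Generation

variable {g : ℕ}

theorem coe_zpow_of_sq_zero {M : Sp g} {N : Matrix (Fin g ⊕ Fin g) (Fin g ⊕ Fin g) ℤ}
    (h : M.1 = 1 + N) (hN : N * N = 0) (k : ℤ) : (M ^ k).1 = 1 + k • N := by
  have hpow : ∀ n : ℕ, (M ^ n).1 = 1 + (n : ℤ) • N := by
    intro n
    induction n with
    | zero => simp
    | succ n ih =>
      rw [pow_succ, Submonoid.coe_mul, ih, h]
      simp only [mul_add, add_mul, mul_one, one_mul, smul_mul_assoc, hN, smul_zero, Nat.cast_succ,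
        add_smul, one_smul]
      abel
  obtain ⟨n, rfl | rfl⟩ := k.eq_nat_or_neg
  · rw [zpow_natCast, hpow]
  · rw [_root_.zpow_neg, zpow_natCast]
    have h1 : (M ^ n).1 * ((M ^ n)⁻¹).1 = 1 := by
      rw [← Submonoid.coe_mul, mul_inv_cancel]; rfl
    have h2 : (1 + (-(n : ℤ)) • N) * (M ^ n).1 = 1 := by
      rw [hpow]
      simp only [mul_add, add_mul, mul_one, one_mul, smul_mul_assoc, mul_smul_comm, hN, smul_zero]
      rw [neg_smul, add_zero, neg_add_cancel_right]
    calc ((M ^ n)⁻¹).1 = (1 + (-(n : ℤ)) • N) * (M ^ n).1 * ((M ^ n)⁻¹).1 := by rw [h2, one_mul]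
      _ = _ := by rw [mul_assoc, h1, mul_one]

/-! ### Explicit matrices of the generators, and their powers as row operations -/

theorem genA_of_ne {i j : Fin g} (h : i ≠ j) : genA i j = 1 + single i j 2 := by
  ext k l
  by_cases hk : k = i <;> by_cases hl : l = j <;>
    simp_all [genA, one_apply, eq_comm]

theorem genA_inv_of_ne {i j : Fin g} (h : i ≠ j) : (genA i j)⁻¹ = 1 - single i j 2 := by
  apply inv_eq_right_inv
  rw [genA_of_ne h]
  simp [mul_sub, add_mul, h.symm]

theorem genB_of_ne {i j : Fin g} (h : i ≠ j) : genB i j = single i j 2 + single j i 2 := by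
  ext k l
  by_cases hk : k = i <;> by_cases hl : l = j <;> by_cases hk' : k = j <;> by_cases hl' : l = i <;>
    simp_all [genB, single_apply, eq_comm]

theorem genB_self (i : Fin g) : genB i i = single i i 2 := by
  ext k l
  by_cases hk : k = i <;> by_cases hl : l = i <;> simp_all [genB, single_apply, eq_comm]

theorem genA_self (i : Fin g) : genA i i = diagonal (fun k => if k = i then (-1 : ℤ) else 1) := by
  ext k l
  by_cases hk : k = i <;> by_cases hl : l = i <;> by_cases hkl : k = l <;>
    simp_all [genA, one_apply]

theorem genA_inv_self (i : Fin g) : (genA i i)⁻¹ = genA i i := by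
  apply inv_eq_right_inv
  rw [genA_self, diagonal_mul_diagonal, ← diagonal_one]
  congr 1
  ext k
  by_cases hk : k = i <;> simp [hk]

theorem coe_A_of_ne {i j : Fin g} (h : i ≠ j) : (A i j).1 =
    1 + (single (Sum.inl i) (Sum.inl j) 2 - single (Sum.inr j) (Sum.inr i) 2) := by
  change fromBlocks (genA i j) 0 0 ((genA i j)⁻¹)ᵀ = _
  rw [genA_inv_of_ne h, genA_of_ne h]
  ext (x | x) (y | y) <;> simp [single_apply, one_apply, eq_comm, and_comm, sub_eq_add_neg]

theorem coe_A_self (i : Fin g) : (A i i).1 =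
    diagonal (fun x => if x = Sum.inl i ∨ x = Sum.inr i then (-1 : ℤ) else 1) := by
  change fromBlocks (genA i i) 0 0 ((genA i i)⁻¹)ᵀ = _
  rw [genA_inv_self, genA_self]
  ext (x | x) (y | y) <;> simp [diagonal_apply]

theorem coe_B_of_ne {i j : Fin g} (h : i ≠ j) : (B i j).1 =
    1 + (single (Sum.inl i) (Sum.inr j) 2 + single (Sum.inl j) (Sum.inr i) 2) := by
  simp only [B, genB_of_ne h]
  ext (x | x) (y | y) <;> simp [single_apply, one_apply]

theorem coe_B_self (i : Fin g) : (B i i).1 = 1 + single (Sum.inl i) (Sum.inr i) 2 := by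
  simp only [B, genB_self]
  ext (x | x) (y | y) <;> simp [single_apply, one_apply]

theorem coe_C_of_ne {i j : Fin g} (h : i ≠ j) : (C i j).1 =
    1 + (single (Sum.inr j) (Sum.inl i) 2 + single (Sum.inr i) (Sum.inl j) 2) := by
  simp only [C, coe_B_of_ne h]
  simp

theorem coe_C_self (i : Fin g) : (C i i).1 = 1 + single (Sum.inr i) (Sum.inl i) 2 := by
  simp only [C, coe_B_self]
  simp

theorem single_mul_apply_eq_ite (x y : Fin g ⊕ Fin g) (c : ℤ)
    (M : Matrix (Fin g ⊕ Fin g) (Fin g ⊕ Fin g) ℤ) (u v : Fin g ⊕ Fin g) :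
    (single x y c * M) u v = if u = x then c * M y v else 0 := by
  by_cases h : u = x
  · subst h; simp
  · simp [h]

theorem A_zpow_mul_apply {i j : Fin g} (h : i ≠ j) (k : ℤ) (M : Sp g) (x y : Fin g ⊕ Fin g) :
    (A i j ^ k * M).1 x y = M.1 x y + 2 * k * ((if x = Sum.inl i then M.1 (Sum.inl j) y else 0)
      - if x = Sum.inr j then M.1 (Sum.inr i) y else 0) := by
  rw [Submonoid.coe_mul, coe_zpow_of_sq_zero (coe_A_of_ne h) (by simp [mul_sub, sub_mul, h, h.symm])]
  simp only [add_mul, one_mul, smul_mul_assoc, sub_mul, Matrix.add_apply, Matrix.smul_apply,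
    Matrix.sub_apply, single_mul_apply_eq_ite, smul_eq_mul]
  split_ifs <;> ring

theorem B_zpow_mul_apply {i j : Fin g} (h : i ≠ j) (k : ℤ) (M : Sp g) (x y : Fin g ⊕ Fin g) :
    (B i j ^ k * M).1 x y = M.1 x y + 2 * k * ((if x = Sum.inl i then M.1 (Sum.inr j) y else 0)
      + if x = Sum.inl j then M.1 (Sum.inr i) y else 0) := by
  rw [Submonoid.coe_mul, coe_zpow_of_sq_zero (coe_B_of_ne h) (by simp [mul_add, add_mul])]
  simp only [add_mul, one_mul, smul_mul_assoc, Matrix.add_apply, Matrix.smul_apply,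
    single_mul_apply_eq_ite, smul_eq_mul]
  split_ifs <;> ring

theorem B_self_zpow_mul_apply (i : Fin g) (k : ℤ) (M : Sp g) (x y : Fin g ⊕ Fin g) :
    (B i i ^ k * M).1 x y = M.1 x y + 2 * k * (if x = Sum.inl i then M.1 (Sum.inr i) y else 0) := by
  rw [Submonoid.coe_mul, coe_zpow_of_sq_zero (coe_B_self i) (by simp)]
  simp only [add_mul, one_mul, smul_mul_assoc, Matrix.add_apply, Matrix.smul_apply,
    single_mul_apply_eq_ite, smul_eq_mul]
  split_ifs <;> ring

theorem C_zpow_mul_apply {i j : Fin g} (h : i ≠ j) (k : ℤ) (M : Sp g) (x y : Fin g ⊕ Fin g) :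
    (C i j ^ k * M).1 x y = M.1 x y + 2 * k * ((if x = Sum.inr i then M.1 (Sum.inl j) y else 0)
      + if x = Sum.inr j then M.1 (Sum.inl i) y else 0) := by
  rw [Submonoid.coe_mul, coe_zpow_of_sq_zero (coe_C_of_ne h) (by simp [mul_add, add_mul])]
  simp only [add_mul, one_mul, smul_mul_assoc, Matrix.add_apply, Matrix.smul_apply,
    single_mul_apply_eq_ite, smul_eq_mul]
  split_ifs <;> ring

theorem C_self_zpow_mul_apply (i : Fin g) (k : ℤ) (M : Sp g) (x y : Fin g ⊕ Fin g) :
    (C i i ^ k * M).1 x y = M.1 x y + 2 * k * (if x = Sum.inr i then M.1 (Sum.inl i) y else 0) := by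
  rw [Submonoid.coe_mul, coe_zpow_of_sq_zero (coe_C_self i) (by simp)]
  simp only [add_mul, one_mul, smul_mul_assoc, Matrix.add_apply, Matrix.smul_apply,
    single_mul_apply_eq_ite, smul_eq_mul]
  split_ifs <;> ring

theorem A_mem_Gamma2 (i j : Fin g) : A i j ∈ Gamma2 g := by
  by_cases h : i = j
  · subst h
    refine mem_Gamma2_of_eq
      (diagonal (fun x => if x = Sum.inl i ∨ x = Sum.inr i then (-1 : ℤ) else 0)) ?_
    rw [coe_A_self, ← diagonal_one, ← diagonal_smul, diagonal_add]
    congr 1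
    ext x
    simp only [Pi.smul_apply, smul_eq_mul]
    split_ifs <;> norm_num
  · refine mem_Gamma2_of_eq
      (single (Sum.inl i) (Sum.inl j) 1 - single (Sum.inr j) (Sum.inr i) 1) ?_
    rw [coe_A_of_ne h, smul_sub, smul_single, smul_single]
    rfl

theorem B_mem_Gamma2 (i j : Fin g) : B i j ∈ Gamma2 g := by
  by_cases h : i = j
  · subst h
    refine mem_Gamma2_of_eq (single (Sum.inl i) (Sum.inr i) 1) ?_
    rw [coe_B_self, smul_single]
    rfl
  · refine mem_Gamma2_of_eq
      (single (Sum.inl i) (Sum.inr j) 1 + single (Sum.inl j) (Sum.inr i) 1) ?_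
    rw [coe_B_of_ne h, smul_add, smul_single, smul_single]
    rfl

theorem C_mem_Gamma2 (i j : Fin g) : C i j ∈ Gamma2 g := by
  have h := B_mem_Gamma2 i j
  obtain ⟨X, hX⟩ := exists_eq_one_add_two_smul h
  refine mem_Gamma2_of_eq Xᵀ ?_
  simp only [C, hX, transpose_add, transpose_one, transpose_smul]

/-- The subgroup generated by the `A_{ij}`, `B_{ij}` and `C_{ij}`. -/
def genGroup (g : ℕ) : Subgroup (Sp g) :=
  Subgroup.closure ({M | ∃ i j, M = A i j} ∪ {M | ∃ i j, M = B i j} ∪ {M | ∃ i j, M = C i j})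

theorem A_mem_genGroup (i j : Fin g) : A i j ∈ genGroup g :=
  Subgroup.subset_closure (Or.inl (Or.inl ⟨i, j, rfl⟩))

theorem B_mem_genGroup (i j : Fin g) : B i j ∈ genGroup g :=
  Subgroup.subset_closure (Or.inl (Or.inr ⟨i, j, rfl⟩))

theorem C_mem_genGroup (i j : Fin g) : C i j ∈ genGroup g :=
  Subgroup.subset_closure (Or.inr ⟨i, j, rfl⟩)

theorem genGroup_le : genGroup g ≤ Gamma2 g := by
  rw [genGroup, Subgroup.closure_le]
  rintro _ ((⟨i, j, rfl⟩ | ⟨i, j, rfl⟩) | ⟨i, j, rfl⟩)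
  exacts [A_mem_Gamma2 i j, B_mem_Gamma2 i j, C_mem_Gamma2 i j]

/-! ### Reduction of one hyperbolic plane at a time -/

/-- The column `y` of `M` is the unit vector. -/
def FixesCol (M : Sp g) (y : Fin g ⊕ Fin g) : Prop :=
  ∀ x, M.1 x y = (1 : Matrix (Fin g ⊕ Fin g) (Fin g ⊕ Fin g) ℤ) x y

/-- `M` fixes the hyperbolic planes with index in `S`. -/
def FixesOn (S : Finset (Fin g)) (M : Sp g) : Prop :=
  ∀ i ∈ S, FixesCol M (Sum.inl i) ∧ FixesCol M (Sum.inr i)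

/-- The index of the hyperbolic plane of a coordinate. -/
def planeIndex : Fin g ⊕ Fin g → Fin g := Sum.elim id id

theorem FixesCol.mul {M N : Sp g} {y : Fin g ⊕ Fin g} (hM : FixesCol M y) (hN : FixesCol N y) :
    FixesCol (M * N) y := by
  intro x
  have hN' : ∀ z, N.1 z y = (1 : Matrix (Fin g ⊕ Fin g) (Fin g ⊕ Fin g) ℤ) z y := hN
  rw [Submonoid.coe_mul, mul_apply]
  simp only [hN', one_apply, mul_ite, mul_one, mul_zero, Finset.sum_ite_eq', Finset.mem_univ,
    if_true]
  simpa [one_apply] using hM x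

theorem FixesOn.mul {S : Finset (Fin g)} {M N : Sp g} (hM : FixesOn S M) (hN : FixesOn S N) :
    FixesOn S (M * N) :=
  fun i hi => ⟨(hM i hi).1.mul (hN i hi).1, (hM i hi).2.mul (hN i hi).2⟩

theorem symp_single_inl (u : Characteristic g) (i : Fin g) :
    symp u (Pi.single (Sum.inl i) 1) = -u (Sum.inr i) := by
  simp [symp, dotProduct, Pi.single_apply]

theorem symp_single_inr (u : Characteristic g) (i : Fin g) :
    symp u (Pi.single (Sum.inr i) 1) = u (Sum.inl i) := by
  simp [symp, dotProduct, Pi.single_apply]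

theorem FixesCol.mulVec {M : Sp g} {y : Fin g ⊕ Fin g} (h : FixesCol M y) :
    M.1 *ᵥ Pi.single y 1 = Pi.single y 1 := by
  ext x
  simp [h x, one_apply, Pi.single_apply]

/-- Pairing with the fixed vector reads off the dual row, and `M` preserves the pairing; so a unit
column forces the dual row to be a unit row. -/
theorem apply_inr_of_fixesCol {M : Sp g} {i : Fin g} (h : FixesCol M (Sum.inl i))
    (y : Fin g ⊕ Fin g) : M.1 (Sum.inr i) y
      = (1 : Matrix (Fin g ⊕ Fin g) (Fin g ⊕ Fin g) ℤ) (Sum.inr i) y := by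
  have h1 := symp_mulVec M (Pi.single y 1) (Pi.single (Sum.inl i) 1)
  rw [h.mulVec, symp_single_inl, symp_single_inl] at h1
  simpa [Pi.single_apply, one_apply] using h1

theorem apply_inl_of_fixesCol {M : Sp g} {i : Fin g} (h : FixesCol M (Sum.inr i))
    (y : Fin g ⊕ Fin g) : M.1 (Sum.inl i) y
      = (1 : Matrix (Fin g ⊕ Fin g) (Fin g ⊕ Fin g) ℤ) (Sum.inl i) y := by
  have h1 := symp_mulVec M (Pi.single y 1) (Pi.single (Sum.inr i) 1)
  rw [h.mulVec, symp_single_inr, symp_single_inr] at h1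
  simpa [Pi.single_apply, one_apply] using h1

/-- The rows of the planes in `S` are already unit rows, so clearing a later column never involves
them and the finished planes stay fixed. -/
theorem planeIndex_notMem {S : Finset (Fin g)} {M : Sp g} (hS : FixesOn S M)
    {x y : Fin g ⊕ Fin g} (hy : planeIndex y ∉ S) (hne : M.1 x y ≠ 0) : planeIndex x ∉ S := by
  intro hx
  have hxy : x ≠ y := by rintro rfl; exact hy hx
  apply hne
  rcases x with i | i
  · rw [apply_inl_of_fixesCol (hS i hx).2, one_apply_ne hxy]
  · rw [apply_inr_of_fixesCol (hS i hx).1, one_apply_ne hxy]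


theorem fixesOn_A_zpow {S : Finset (Fin g)} {i j : Fin g} (h : i ≠ j) (hi : i ∉ S) (hj : j ∉ S)
    (k : ℤ) : FixesOn S (A i j ^ k) := by
  intro s hs
  have hsi : i ≠ s := by rintro rfl; exact hi hs
  have hsj : j ≠ s := by rintro rfl; exact hj hs
  constructor <;> intro x <;> have := A_zpow_mul_apply h k 1 x <;>
    simp only [mul_one] at this <;> rw [this] <;> simp [one_apply, hsi, hsj]

theorem fixesOn_B_zpow {S : Finset (Fin g)} {i j : Fin g} (hi : i ∉ S) (hj : j ∉ S)
    (k : ℤ) : FixesOn S (B i j ^ k) := by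
  intro s hs
  have hsi : i ≠ s := by rintro rfl; exact hi hs
  have hsj : j ≠ s := by rintro rfl; exact hj hs
  by_cases h : i = j
  · subst h
    constructor <;> intro x <;> have := B_self_zpow_mul_apply i k 1 x <;>
      simp only [mul_one] at this <;> rw [this] <;> simp [one_apply, hsi]
  · constructor <;> intro x <;> have := B_zpow_mul_apply h k 1 x <;>
      simp only [mul_one] at this <;> rw [this] <;> simp [one_apply, hsi, hsj]

theorem fixesOn_C_zpow {S : Finset (Fin g)} {i j : Fin g} (hi : i ∉ S) (hj : j ∉ S)
    (k : ℤ) : FixesOn S (C i j ^ k) := by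
  intro s hs
  have hsi : i ≠ s := by rintro rfl; exact hi hs
  have hsj : j ≠ s := by rintro rfl; exact hj hs
  by_cases h : i = j
  · subst h
    constructor <;> intro x <;> have := C_self_zpow_mul_apply i k 1 x <;>
      simp only [mul_one] at this <;> rw [this] <;> simp [one_apply, hsi]
  · constructor <;> intro x <;> have := C_zpow_mul_apply h k 1 x <;>
      simp only [mul_one] at this <;> rw [this] <;> simp [one_apply, hsi, hsj]

/-- Adding `2k` times the row `inl j` to the row `x`, at the cost of the row `inr j`. -/
theorem exists_add_pivot_row {S : Finset (Fin g)} {j : Fin g} (hj : j ∉ S) {x : Fin g ⊕ Fin g}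
    (hx : planeIndex x ∉ S) (hxj : x ≠ Sum.inl j) (k : ℤ) :
    ∃ E ∈ genGroup g, FixesOn S E ∧ ∀ M : Sp g, ∀ z,
      (E * M).1 x z = M.1 x z + 2 * k * M.1 (Sum.inl j) z ∧
      ∀ y, y ≠ x → y ≠ Sum.inr j → (E * M).1 y z = M.1 y z := by
  rcases x with i | i
  · have hij : i ≠ j := fun h => hxj (by rw [h])
    refine ⟨A i j ^ k, zpow_mem (A_mem_genGroup i j) k, fixesOn_A_zpow hij hx hj k, ?_⟩
    intro M z
    refine ⟨by simp [A_zpow_mul_apply hij], fun y hy hy' => by simp [A_zpow_mul_apply hij, hy, hy']⟩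
  · refine ⟨C i j ^ k, zpow_mem (C_mem_genGroup i j) k, fixesOn_C_zpow hx hj k, ?_⟩
    intro M z
    by_cases hij : i = j
    · subst hij
      exact ⟨by simp [C_self_zpow_mul_apply],
        fun y hy hy' => by simp [C_self_zpow_mul_apply, hy]⟩
    · exact ⟨by simp [C_zpow_mul_apply hij, hij],
        fun y hy hy' => by simp [C_zpow_mul_apply hij, hy, hy']⟩

/-- Adding `2k` times the row `x` to the row `inl j`. -/
theorem exists_add_to_pivot_row {S : Finset (Fin g)} {j : Fin g} (hj : j ∉ S) {x : Fin g ⊕ Fin g}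
    (hx : planeIndex x ∉ S) (hxj : x ≠ Sum.inl j) (k : ℤ) :
    ∃ E ∈ genGroup g, FixesOn S E ∧ ∀ M : Sp g, ∀ z,
      (E * M).1 (Sum.inl j) z = M.1 (Sum.inl j) z + 2 * k * M.1 x z := by
  rcases x with i | i
  · have hij : j ≠ i := fun h => hxj (by rw [h])
    refine ⟨A j i ^ k, zpow_mem (A_mem_genGroup j i) k, fixesOn_A_zpow hij hj hx k, ?_⟩
    intro M z
    simp [A_zpow_mul_apply hij]
  · refine ⟨B j i ^ k, zpow_mem (B_mem_genGroup j i) k, fixesOn_B_zpow hj hx k, ?_⟩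
    intro M z
    by_cases hij : j = i
    · subst hij
      simp [B_self_zpow_mul_apply]
    · simp [B_zpow_mul_apply hij, hij]

/-- Adding `2k` times the row `inr j` to the row `x`, at the cost of the row `inl j`, by an element
that fixes the unit vector of index `inl j`. -/
theorem exists_add_dual_row {S : Finset (Fin g)} {j : Fin g} (hj : j ∉ S) {x : Fin g ⊕ Fin g}
    (hx : planeIndex x ∉ S) (hxj : x ≠ Sum.inr j) (k : ℤ) :
    ∃ E ∈ genGroup g, FixesOn S E ∧ FixesCol E (Sum.inl j) ∧ ∀ M : Sp g, ∀ z,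
      (E * M).1 x z = M.1 x z + 2 * k * M.1 (Sum.inr j) z ∧
      ∀ y, y ≠ x → y ≠ Sum.inl j → (E * M).1 y z = M.1 y z := by
  rcases x with i | i
  · refine ⟨B i j ^ k, zpow_mem (B_mem_genGroup i j) k, fixesOn_B_zpow hx hj k, ?_, ?_⟩
    · intro x
      by_cases hij : i = j
      · subst hij
        have := B_self_zpow_mul_apply i k 1 x (Sum.inl i)
        simp only [mul_one] at this
        simp [this]
      · have := B_zpow_mul_apply hij k 1 x (Sum.inl j)
        simp only [mul_one] at this
        simp [this]
    intro M z
    by_cases hij : i = j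
    · subst hij
      exact ⟨by simp [B_self_zpow_mul_apply],
        fun y hy hy' => by simp [B_self_zpow_mul_apply, hy]⟩
    · exact ⟨by simp [B_zpow_mul_apply hij, hij],
        fun y hy hy' => by simp [B_zpow_mul_apply hij, hy, hy']⟩
  · have hij : j ≠ i := fun h => hxj (by rw [h])
    refine ⟨A j i ^ (-k), zpow_mem (A_mem_genGroup j i) _, fixesOn_A_zpow hij hj hx _, ?_, ?_⟩
    · intro x
      have := A_zpow_mul_apply hij (-k) 1 x (Sum.inl j)
      simp only [mul_one] at this
      rw [this]
      simp [hij.symm]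
    intro M z
    refine ⟨by rw [A_zpow_mul_apply hij]; simp,
      fun y hy hy' => by rw [A_zpow_mul_apply hij]; simp [hy, hy']⟩

/-- Division with centred remainder modulo `2|x|`. -/
theorem exists_abs_add_two_mul_le (a : ℤ) {x : ℤ} (hx : x ≠ 0) : ∃ k : ℤ, |a + 2 * k * x| ≤ |x| := by
  have hpos : 0 < |x| := abs_pos.2 hx
  -- With this `k` the sum is `(a + |x|) mod 2|x|` minus `|x|`; the sign turns `x` into `|x|`.
  refine ⟨-((a + |x|) / (2 * |x|)) * x.sign, ?_⟩
  have h1 : 2 * (-((a + |x|) / (2 * |x|)) * x.sign) * x = -(2 * |x| * ((a + |x|) / (2 * |x|))) := by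
    rw [← Int.sign_mul_self_eq_abs x]; ring
  rw [h1]
  have h2 := Int.emod_add_mul_ediv (a + |x|) (2 * |x|)
  have h3 := Int.emod_nonneg (a + |x|) (b := 2 * |x|) (by lia)
  have h4 := Int.emod_lt_of_pos (a + |x|) (b := 2 * |x|) (by lia)
  rw [abs_le]
  constructor <;> lia

theorem odd_diag {M : Sp g} (hM : M ∈ Gamma2 g) (x : Fin g ⊕ Fin g) : Odd (M.1 x x) := by
  obtain ⟨X, hX⟩ := exists_eq_one_add_two_smul hM
  refine ⟨X x x, ?_⟩
  rw [hX]
  simp only [Matrix.add_apply, one_apply_eq, Matrix.smul_apply, smul_eq_mul]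
  ring

theorem even_offDiag {M : Sp g} (hM : M ∈ Gamma2 g) {x y : Fin g ⊕ Fin g} (h : x ≠ y) :
    Even (M.1 x y) := by
  obtain ⟨X, hX⟩ := exists_eq_one_add_two_smul hM
  refine ⟨X x y, ?_⟩
  rw [hX]
  simp only [Matrix.add_apply, one_apply_ne h, Matrix.smul_apply, smul_eq_mul]
  ring

theorem isUnit_of_dvd_col {M : Sp g} {y : Fin g ⊕ Fin g} {d : ℤ} (h : ∀ x, d ∣ M.1 x y) :
    IsUnit d := by
  have h1 : (M⁻¹).1 * M.1 = 1 := by rw [← Submonoid.coe_mul, inv_mul_cancel]; rfl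
  have h2 := congrFun (congrFun h1 y) y
  rw [mul_apply, one_apply_eq] at h2
  exact isUnit_of_dvd_one (h2 ▸ Finset.dvd_sum fun z _ => (h z).mul_left _)

/-- A pivot that does not divide the column can be made smaller. -/
theorem exists_smaller_pivot {S : Finset (Fin g)} {j : Fin g} (hj : j ∉ S) {M : Sp g}
    (hM : M ∈ Gamma2 g) (hS : FixesOn S M) {x : Fin g ⊕ Fin g} (hxj : x ≠ Sum.inl j)
    (hdvd : ¬ 2 * M.1 (Sum.inl j) (Sum.inl j) ∣ M.1 x (Sum.inl j)) :
    ∃ E ∈ genGroup g, FixesOn S E ∧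
      |(E * M).1 (Sum.inl j) (Sum.inl j)| < |M.1 (Sum.inl j) (Sum.inl j)| := by
  have hx : planeIndex x ∉ S := by
    refine planeIndex_notMem hS (y := Sum.inl j) hj ?_
    intro h0
    exact hdvd (h0 ▸ dvd_zero _)
  have hodd := odd_diag hM (Sum.inl j)
  have heven := even_offDiag hM hxj
  obtain ⟨k, hk⟩ := exists_abs_add_two_mul_le (M.1 x (Sum.inl j))
    (x := M.1 (Sum.inl j) (Sum.inl j)) (by rintro h0; rw [h0] at hodd; simp at hodd)
  obtain ⟨E, hE, hES, hEM⟩ := exists_add_pivot_row hj hx hxj k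
  have h1 := (hEM M (Sum.inl j)).1
  have h2 := (hEM M (Sum.inl j)).2 (Sum.inl j) hxj.symm (by simp)
  -- The entry was reduced modulo twice the pivot; now the pivot is reduced modulo twice the new
  -- entry. That entry is nonzero, since otherwise twice the pivot would divide the old one.
  obtain ⟨l, hl⟩ := exists_abs_add_two_mul_le (M.1 (Sum.inl j) (Sum.inl j))
    (x := (E * M).1 x (Sum.inl j)) (by
      intro h0
      exact hdvd ⟨-k, by linear_combination h0 - h1⟩)
  obtain ⟨F, hF, hFS, hFM⟩ := exists_add_to_pivot_row hj hx hxj l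
  refine ⟨F * E, mul_mem hF hE, hFS.mul hES, ?_⟩
  rw [mul_assoc, hFM, h2]
  refine lt_of_le_of_lt hl ?_
  rw [h1]
  refine lt_of_le_of_ne hk ?_
  -- Equality of absolute values is excluded by parity: the pivot is odd and the entry even.
  intro h0
  obtain ⟨u, hu⟩ := hodd
  obtain ⟨v, hv⟩ := heven
  rw [abs_eq_abs] at h0
  rw [hv, hu] at h0
  have : 2 * k * (2 * u + 1) = 2 * (k * (2 * u + 1)) := by ring
  lia

/-- Number of nonzero entries in the column `y` of `M` outside the hyperbolic plane of `y`. -/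
def offCount (M : Sp g) (y : Fin g ⊕ Fin g) : ℕ :=
  (Finset.univ.filter fun x => planeIndex x ≠ planeIndex y ∧ M.1 x y ≠ 0).card

theorem offCount_lt {M N : Sp g} {x y : Fin g ⊕ Fin g} (hx : planeIndex x ≠ planeIndex y)
    (hMx : M.1 x y ≠ 0) (hNx : N.1 x y = 0)
    (h : ∀ z, z ≠ x → planeIndex z ≠ planeIndex y → N.1 z y = M.1 z y) :
    offCount N y < offCount M y := by
  apply Finset.card_lt_card
  rw [Finset.ssubset_iff_of_subset]
  · exact ⟨x, by simp [hx, hMx], by simp [hNx]⟩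
  · intro z hz
    simp only [Finset.mem_filter, Finset.mem_univ, true_and] at hz ⊢
    have hzx : z ≠ x := by rintro rfl; exact hz.2 hNx
    exact ⟨hz.1, by rw [← h z hzx hz.1]; exact hz.2⟩

theorem eq_zero_of_offCount_eq_zero {M : Sp g} {x y : Fin g ⊕ Fin g} (h : offCount M y = 0)
    (hx : planeIndex x ≠ planeIndex y) : M.1 x y = 0 := by
  by_contra h0
  rw [offCount, Finset.card_eq_zero, Finset.filter_eq_empty_iff] at h
  exact h (Finset.mem_univ x) ⟨hx, h0⟩

theorem exists_of_offCount_ne_zero {M : Sp g} {y : Fin g ⊕ Fin g} (h : offCount M y ≠ 0) :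
    ∃ x, planeIndex x ≠ planeIndex y ∧ M.1 x y ≠ 0 := by
  obtain ⟨x, hx⟩ := Finset.card_pos.1 (Nat.pos_of_ne_zero h)
  simp only [Finset.mem_filter, Finset.mem_univ, true_and] at hx
  exact ⟨x, hx⟩

theorem eq_or_eq_of_planeIndex {x : Fin g ⊕ Fin g} {j : Fin g} (h : planeIndex x = j) :
    x = Sum.inl j ∨ x = Sum.inr j := by
  rcases x with i | i
  · exact Or.inl (congrArg _ h)
  · exact Or.inr (congrArg _ h)

/-- The only nonzero entry in a column of an invertible integral matrix is `±1`; `A j j` repairs the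
sign. -/
theorem exists_fixesCol_of_unit {S : Finset (Fin g)} {j : Fin g} (hj : j ∉ S) {M : Sp g}
    (hS : FixesOn S M)
    (h0 : ∀ x, x ≠ Sum.inl j → M.1 x (Sum.inl j) = 0) :
    ∃ E ∈ genGroup g, FixesOn S (E * M) ∧ FixesCol (E * M) (Sum.inl j) := by
  have hu : IsUnit (M.1 (Sum.inl j) (Sum.inl j)) := by
    refine isUnit_of_dvd_col (M := M) (y := Sum.inl j) fun x => ?_
    by_cases hx : x = Sum.inl j
    · rw [hx]
    · rw [h0 x hx]; exact dvd_zero _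
  rcases Int.isUnit_iff.1 hu with h1 | h1
  · refine ⟨1, one_mem _, by rwa [one_mul], ?_⟩
    intro x
    rw [one_mul]
    by_cases hx : x = Sum.inl j
    · rw [hx, h1, one_apply_eq]
    · rw [h0 x hx, one_apply_ne hx]
  · refine ⟨A j j, A_mem_genGroup j j, FixesOn.mul ?_ hS, ?_⟩
    · intro s hs
      have hsj : s ≠ j := by rintro rfl; exact hj hs
      constructor <;> intro x <;> rw [coe_A_self] <;> by_cases hx : x = Sum.inl s <;>
        by_cases hx' : x = Sum.inr s <;> simp_all [one_apply]
    · intro x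
      rw [Submonoid.coe_mul, coe_A_self, diagonal_mul]
      by_cases hx : x = Sum.inl j
      · rw [hx, h1]; simp
      · rw [h0 x hx, one_apply_ne hx]; simp

/-- Lexicographic induction on the size of the pivot and the number of nonzero entries outside its
plane: either the pivot shrinks, or it stays and one entry is cleared. -/
theorem exists_fixesCol_inl {S : Finset (Fin g)} {j : Fin g} (hj : j ∉ S) :
    ∀ (n N : ℕ) (M : Sp g), M ∈ Gamma2 g → FixesOn S M →
      (M.1 (Sum.inl j) (Sum.inl j)).natAbs = n → offCount M (Sum.inl j) = N →
      ∃ E ∈ genGroup g, FixesOn S (E * M) ∧ FixesCol (E * M) (Sum.inl j) := by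
  intro n
  induction n using Nat.strong_induction_on with
  | _ n ihn =>
  intro N
  induction N using Nat.strong_induction_on with
  | _ N ihN =>
  intro M hM hS hn hN
  by_cases hdvd : ∀ x, x ≠ Sum.inl j →
      2 * M.1 (Sum.inl j) (Sum.inl j) ∣ M.1 x (Sum.inl j)
  · by_cases hN0 : N = 0
    -- The dual row `inr j` is cleared last, because clearing any other row disturbs it; `offCount`
    -- leaves it out for the same reason.
    · obtain ⟨k, hk⟩ := hdvd (Sum.inr j) (by simp)
      obtain ⟨E, hE, hES, hEM⟩ := exists_add_pivot_row (x := Sum.inr j) hj hj (by simp) (-k)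
      obtain ⟨F, hF, hFS, hFc⟩ := exists_fixesCol_of_unit hj (hES.mul hS) (by
        intro x hx
        by_cases hx' : x = Sum.inr j
        · rw [hx', (hEM M _).1, hk]; ring
        · rw [(hEM M _).2 x hx' hx']
          refine eq_zero_of_offCount_eq_zero (hN.trans hN0) ?_
          intro h
          rcases eq_or_eq_of_planeIndex h with h | h
          exacts [hx h, hx' h])
      exact ⟨F * E, mul_mem hF hE, by rwa [mul_assoc], by rwa [mul_assoc]⟩
    · obtain ⟨x, hx, hx0⟩ := exists_of_offCount_ne_zero (hN.trans_ne hN0)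
      have hxl : x ≠ Sum.inl j := by rintro rfl; exact hx rfl
      have hxr : x ≠ Sum.inr j := by rintro rfl; exact hx rfl
      obtain ⟨k, hk⟩ := hdvd x hxl
      obtain ⟨E, hE, hES, hEM⟩ := exists_add_pivot_row hj
        (planeIndex_notMem hS (y := Sum.inl j) hj hx0) hxl (-k)
      obtain ⟨F, hF, hFS, hFc⟩ := ihN (offCount (E * M) (Sum.inl j)) (hN ▸ offCount_lt hx hx0
        (by rw [(hEM M _).1, hk]; ring)
        (fun z hz hz' => (hEM M _).2 z hz (by rintro rfl; exact hz' rfl))) (E * M)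
        (mul_mem (genGroup_le hE) hM) (hES.mul hS)
        (by rw [(hEM M _).2 _ hxl.symm (by simp), hn]) rfl
      exact ⟨F * E, mul_mem hF hE, by rwa [mul_assoc], by rwa [mul_assoc]⟩
  · push Not at hdvd
    obtain ⟨x, hx, hd⟩ := hdvd
    obtain ⟨E, hE, hES, hlt⟩ := exists_smaller_pivot hj hM hS hx hd
    obtain ⟨F, hF, hFS, hFc⟩ := ihn _ (by rw [← hn]; zify; exact hlt) _ (E * M)
      (mul_mem (genGroup_le hE) hM) (hES.mul hS) rfl rfl
    exact ⟨F * E, mul_mem hF hE, by rwa [mul_assoc], by rwa [mul_assoc]⟩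

/-- No Euclidean step is needed: once the column `inl j` is fixed, symplecticity makes the pivot of
its dual equal to 1, and the even entries are cleared directly. -/
theorem exists_fixesCol_inr {S : Finset (Fin g)} {j : Fin g} (hj : j ∉ S) :
    ∀ (N : ℕ) (M : Sp g), M ∈ Gamma2 g → FixesOn S M → FixesCol M (Sum.inl j) →
      offCount M (Sum.inr j) = N →
      ∃ E ∈ genGroup g, FixesOn S (E * M) ∧ FixesCol (E * M) (Sum.inl j) ∧
        FixesCol (E * M) (Sum.inr j) := by
  intro N
  induction N using Nat.strong_induction_on with
  | _ N ihN =>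
  intro M hM hS hc hN
  have hp : M.1 (Sum.inr j) (Sum.inr j) = 1 := by
    rw [apply_inr_of_fixesCol hc, one_apply_eq]
  by_cases hN0 : N = 0
  · obtain ⟨k, hk⟩ := even_offDiag hM (x := Sum.inl j) (y := Sum.inr j) (by simp)
    obtain ⟨E, hE, hES, hEc, hEM⟩ := exists_add_dual_row (x := Sum.inl j) hj hj (by simp) (-k)
    refine ⟨E, hE, hES.mul hS, hEc.mul hc, ?_⟩
    intro x
    by_cases hx' : x = Sum.inl j
    · rw [hx', (hEM M _).1, hk, hp]; simp; ring
    · rw [(hEM M _).2 x hx' hx']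
      by_cases hx : x = Sum.inr j
      · rw [hx, hp, one_apply_eq]
      · rw [one_apply_ne hx]
        refine eq_zero_of_offCount_eq_zero (hN.trans hN0) ?_
        intro h
        rcases eq_or_eq_of_planeIndex h with h | h
        exacts [hx' h, hx h]
  · obtain ⟨x, hx, hx0⟩ := exists_of_offCount_ne_zero (hN.trans_ne hN0)
    have hxl : x ≠ Sum.inl j := by rintro rfl; exact hx rfl
    have hxr : x ≠ Sum.inr j := by rintro rfl; exact hx rfl
    obtain ⟨k, hk⟩ := even_offDiag hM hxr
    obtain ⟨E, hE, hES, hEc, hEM⟩ := exists_add_dual_row hj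
      (planeIndex_notMem hS (y := Sum.inr j) hj hx0) hxr (-k)
    obtain ⟨F, hF, hFS, hFc⟩ := ihN (offCount (E * M) (Sum.inr j)) (hN ▸ offCount_lt hx hx0
      (by rw [(hEM M _).1, hk, hp]; ring)
      (fun z hz hz' => (hEM M _).2 z hz (by rintro rfl; exact hz' rfl))) (E * M)
      (mul_mem (genGroup_le hE) hM) (hES.mul hS) (hEc.mul hc) rfl
    exact ⟨F * E, mul_mem hF hE, by rwa [mul_assoc], by rwa [mul_assoc]⟩

/-- Induction on the number of planes not yet fixed; when none is left, all columns are unit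
columns. -/
theorem mem_genGroup_of_fixesOn : ∀ (n : ℕ) (S : Finset (Fin g)), Sᶜ.card = n → ∀ M : Sp g,
    M ∈ Gamma2 g → FixesOn S M → M ∈ genGroup g := by
  intro n
  induction n with
  | zero =>
    intro S hS M _ hMS
    have hS : S = Finset.univ := by simpa using hS
    have : M = 1 := by
      apply Subtype.ext
      ext x (y | y)
      · exact (hMS y (by simp [hS])).1 x
      · exact (hMS y (by simp [hS])).2 x
    rw [this]
    exact one_mem _
  | succ n ih =>
    intro S hS M hM hMS
    obtain ⟨j, hj⟩ := Finset.card_pos.1 (by rw [hS]; exact n.succ_pos : 0 < Sᶜ.card)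
    rw [Finset.mem_compl] at hj
    obtain ⟨E, hE, hES, hEc⟩ := exists_fixesCol_inl hj _ _ M hM hMS rfl rfl
    have hE2 : E * M ∈ Gamma2 g := mul_mem (genGroup_le hE) hM
    obtain ⟨F, hF, hFS, hFl, hFr⟩ := exists_fixesCol_inr hj _ (E * M) hE2 hES hEc rfl
    have hmem : F * (E * M) ∈ genGroup g := by
      refine ih (insert j S) ?_ _ (mul_mem (genGroup_le hF) hE2) ?_
      · rw [Finset.compl_insert, Finset.card_erase_of_mem (by simpa using hj), hS]
        rfl
      · intro i hi
        rcases Finset.mem_insert.1 hi with rfl | hi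
        exacts [⟨hFl, hFr⟩, hFS i hi]
    exact (Subgroup.mul_mem_cancel_left _ hE).1 ((Subgroup.mul_mem_cancel_left _ hF).1 hmem)

/-- `Γ_g(2)` is generated by the `A_{ij}`, `B_{ij}` and `C_{ij}`. -/
theorem genGroup_eq : genGroup g = Gamma2 g :=
  le_antisymm genGroup_le fun M hM =>
    mem_genGroup_of_fixesOn _ ∅ rfl M hM (by simp [FixesOn])

end Generation

/-! ### The action on the Siegel upper half-space -/

section HalfSpace

variable {g : ℕ}

theorem toC_mul (X Y : Matrix (Fin g) (Fin g) ℤ) : toC (X * Y) = toC X * toC Y :=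
  Matrix.map_mul (f := Int.castRingHom ℂ)

theorem toC_add (X Y : Matrix (Fin g) (Fin g) ℤ) : toC (X + Y) = toC X + toC Y := by
  ext i j; simp [toC]

theorem toC_sub (X Y : Matrix (Fin g) (Fin g) ℤ) : toC (X - Y) = toC X - toC Y := by
  ext i j; simp [toC]

theorem toC_one : toC (1 : Matrix (Fin g) (Fin g) ℤ) = 1 := by
  ext i j; simp [toC, one_apply]

theorem toC_zero : toC (0 : Matrix (Fin g) (Fin g) ℤ) = 0 := by
  ext i j; simp [toC]

theorem toC_transpose (X : Matrix (Fin g) (Fin g) ℤ) : toC Xᵀ = (toC X)ᵀ := rfl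

theorem toC_conjTranspose (X : Matrix (Fin g) (Fin g) ℤ) : (toC X)ᴴ = (toC X)ᵀ := by
  ext i j; simp [toC]

theorem coe_eq_fromBlocks (M : Sp g) :
    M.1 = fromBlocks (blkA M) (blkB M) (blkC M) (blkD M) := (fromBlocks_toBlocks M.1).symm

theorem transpose_mul_J_mul (M : Sp g) : M.1ᵀ * J (Fin g) ℤ * M.1 = J (Fin g) ℤ :=
  SymplecticGroup.mem_iff'.1 M.2

theorem blk_relations (M : Sp g) :
    (blkA M)ᵀ * blkC M = (blkC M)ᵀ * blkA M ∧ (blkB M)ᵀ * blkD M = (blkD M)ᵀ * blkB M ∧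
      (blkA M)ᵀ * blkD M - (blkC M)ᵀ * blkB M = 1 ∧ (blkD M)ᵀ * blkA M - (blkB M)ᵀ * blkC M = 1 := by
  have h := transpose_mul_J_mul M
  rw [coe_eq_fromBlocks M, J, fromBlocks_transpose, fromBlocks_multiply, fromBlocks_multiply,
    fromBlocks_inj] at h
  simp only [mul_zero, mul_one, zero_add, add_zero, mul_neg, neg_mul] at h
  obtain ⟨h1, h2, h3, h4⟩ := h
  refine ⟨?_, ?_, ?_, ?_⟩
  · rw [← sub_eq_zero, ← neg_eq_zero, ← h1]; abel
  · rw [← sub_eq_zero, ← neg_eq_zero, ← h4]; abel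
  · rw [← neg_inj, ← h2]; abel
  · rw [← h3]; abel

theorem blk_mul (M N : Sp g) :
    blkA (M * N) = blkA M * blkA N + blkB M * blkC N ∧
    blkB (M * N) = blkA M * blkB N + blkB M * blkD N ∧
    blkC (M * N) = blkC M * blkA N + blkD M * blkC N ∧
    blkD (M * N) = blkC M * blkB N + blkD M * blkD N := by
  have h : (M * N).1 = M.1 * N.1 := rfl
  rw [coe_eq_fromBlocks M, coe_eq_fromBlocks N, coe_eq_fromBlocks (M * N), fromBlocks_multiply,
    fromBlocks_inj] at h
  exact h

theorem blk_one : blkA (1 : Sp g) = 1 ∧ blkB (1 : Sp g) = 0 ∧ blkC (1 : Sp g) = 0 ∧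
    blkD (1 : Sp g) = 1 := by
  have h : (1 : Sp g).1 = fromBlocks 1 0 0 1 := by rw [fromBlocks_one]; rfl
  rw [coe_eq_fromBlocks, fromBlocks_inj] at h
  exact h

/-- `aτ + b`. -/
def actNum (M : Sp g) (τ : Matrix (Fin g) (Fin g) ℂ) : Matrix (Fin g) (Fin g) ℂ :=
  toC (blkA M) * τ + toC (blkB M)

theorem toC_relations (M : Sp g) :
    (toC (blkA M))ᵀ * toC (blkC M) = (toC (blkC M))ᵀ * toC (blkA M) ∧
    (toC (blkB M))ᵀ * toC (blkD M) = (toC (blkD M))ᵀ * toC (blkB M) ∧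
    (toC (blkA M))ᵀ * toC (blkD M) - (toC (blkC M))ᵀ * toC (blkB M) = 1 ∧
    (toC (blkD M))ᵀ * toC (blkA M) - (toC (blkB M))ᵀ * toC (blkC M) = 1 := by
  obtain ⟨h1, h2, h3, h4⟩ := blk_relations M
  simp only [← toC_transpose, ← toC_mul, ← toC_sub, h1, h2, h3, h4, toC_one, and_self]

/-- This is the symmetry of Mτ with the inverse of cτ + d cleared. -/
theorem autFactor_transpose_mul_actNum (M : Sp g) {τ : Matrix (Fin g) (Fin g) ℂ} (hτ : τᵀ = τ) :
    (autFactor M τ)ᵀ * actNum M τ = (actNum M τ)ᵀ * autFactor M τ := by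
  obtain ⟨h1, h2, h3, h4⟩ := toC_relations M
  simp only [autFactor, actNum, transpose_add, transpose_mul, hτ]
  linear_combination (norm := noncomm_ring) (-1 : Matrix (Fin g) (Fin g) ℂ) * τ * h1 * τ - h2
    - τ * h3 + h4 * τ

/-- The Hermitian counterpart, which controls the imaginary part of Mτ. -/
theorem autFactor_conjTranspose_mul_actNum (M : Sp g) (τ : Matrix (Fin g) (Fin g) ℂ) :
    (autFactor M τ)ᴴ * actNum M τ - (actNum M τ)ᴴ * autFactor M τ = τ - τᴴ := by
  obtain ⟨h1, h2, h3, h4⟩ := toC_relations M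
  simp only [autFactor, actNum, conjTranspose_add, conjTranspose_mul, toC_conjTranspose]
  linear_combination (norm := noncomm_ring) (-1 : Matrix (Fin g) (Fin g) ℂ) * τᴴ * h1 * τ - h2
    - τᴴ * h3 + h4 * τ

/-- The contribution of Re τ is antisymmetric in the two summation indices, hence zero. -/
theorem im_star_dotProduct {τ : Matrix (Fin g) (Fin g) ℂ} (hτ : τᵀ = τ) (v : Fin g → ℂ) :
    (star v ⬝ᵥ (τ *ᵥ v)).im =
      (fun i => (v i).re) ⬝ᵥ ((τ.map Complex.im) *ᵥ fun i => (v i).re) +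
      (fun i => (v i).im) ⬝ᵥ ((τ.map Complex.im) *ᵥ fun i => (v i).im) := by
  have hs : ∀ i j, τ i j = τ j i := fun i j => congrFun (congrFun hτ j) i
  have hzero : ∑ i, ∑ j, (τ i j).re * ((v i).re * (v j).im - (v i).im * (v j).re) = 0 := by
    have h : ∑ i, ∑ j, (τ i j).re * ((v i).re * (v j).im - (v i).im * (v j).re)
        = -∑ i, ∑ j, (τ i j).re * ((v i).re * (v j).im - (v i).im * (v j).re) := by
      conv_lhs => rw [Finset.sum_comm]
      simp only [← Finset.sum_neg_distrib]
      refine Finset.sum_congr rfl fun i _ => Finset.sum_congr rfl fun j _ => ?_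
      rw [hs j i]; ring
    linarith
  rw [← add_zero (_ + _), ← hzero]
  simp only [dotProduct, mulVec, Complex.im_sum, Finset.mul_sum, ← Finset.sum_add_distrib,
    map_apply]
  refine Finset.sum_congr rfl fun i _ => Finset.sum_congr rfl fun j _ => ?_
  simp only [Pi.star_apply, RCLike.star_def, Complex.mul_im, Complex.mul_re, Complex.conj_re,
    Complex.conj_im]
  ring

/-- Positivity is needed on complex vectors, because cτ + d moves real vectors to complex ones. -/
theorem mem_siegelUpperHalf_iff {τ : Matrix (Fin g) (Fin g) ℂ} :
    τ ∈ SiegelUpperHalf g ↔ τᵀ = τ ∧ ∀ v : Fin g → ℂ, v ≠ 0 → 0 < (star v ⬝ᵥ (τ *ᵥ v)).im := by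
  constructor
  · rintro ⟨hτ, hpos⟩
    refine ⟨hτ, fun v hv => ?_⟩
    rw [im_star_dotProduct hτ]
    have hnn : ∀ x : Fin g → ℝ, 0 ≤ x ⬝ᵥ ((τ.map Complex.im) *ᵥ x) := fun x => by
      simpa using hpos.posSemidef.dotProduct_mulVec_nonneg x
    have hp : ∀ x : Fin g → ℝ, x ≠ 0 → 0 < x ⬝ᵥ ((τ.map Complex.im) *ᵥ x) := fun x hx => by
      simpa using hpos.dotProduct_mulVec_pos hx
    by_cases hre : (fun i => (v i).re) = 0
    · refine add_pos_of_nonneg_of_pos (hnn _) (hp _ fun him => hv ?_)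
      ext i
      exact Complex.ext (congrFun hre i) (congrFun him i)
    · exact add_pos_of_pos_of_nonneg (hp _ hre) (hnn _)
  · rintro ⟨hτ, hpos⟩
    refine ⟨hτ, PosDef.of_dotProduct_mulVec_pos ?_ fun x hx => ?_⟩
    · ext i j
      simp only [conjTranspose_apply, map_apply, star_trivial]
      rw [← congrFun (congrFun hτ i) j, transpose_apply]
    · have h := hpos (fun i => (x i : ℂ)) (by
        intro h0; apply hx; ext i
        simpa using congrFun h0 i)
      rw [im_star_dotProduct hτ] at h
      have h0 : (fun i : Fin g => (0 : ℝ)) = 0 := rfl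
      simpa [h0] using h

/-- One identity serves twice: it excludes a kernel of cτ + d, and it transports positivity from τ
to Mτ. -/
theorem star_dotProduct_actNum (M : Sp g) (τ : Matrix (Fin g) (Fin g) ℂ) (v : Fin g → ℂ) :
    (star (autFactor M τ *ᵥ v) ⬝ᵥ (actNum M τ *ᵥ v)).im = (star v ⬝ᵥ (τ *ᵥ v)).im := by
  have key : star v ⬝ᵥ (((autFactor M τ)ᴴ * actNum M τ - (actNum M τ)ᴴ * autFactor M τ) *ᵥ v)
      = star v ⬝ᵥ ((τ - τᴴ) *ᵥ v) := by
    rw [autFactor_conjTranspose_mul_actNum]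
  have h1 : ∀ X Y : Matrix (Fin g) (Fin g) ℂ,
      star v ⬝ᵥ ((Xᴴ * Y) *ᵥ v) = star (X *ᵥ v) ⬝ᵥ (Y *ᵥ v) := by
    intro X Y
    rw [star_mulVec, ← mulVec_mulVec, dotProduct_mulVec]
  have h2 : ∀ u w : Fin g → ℂ, (star u ⬝ᵥ w).im = -(star w ⬝ᵥ u).im := by
    intro u w
    rw [← star_star (star u ⬝ᵥ w), ← star_dotProduct_star, star_star, dotProduct_comm]
    simp
  have h3 : star v ⬝ᵥ (τᴴ *ᵥ v) = star (τ *ᵥ v) ⬝ᵥ v := by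
    rw [star_mulVec, dotProduct_mulVec]
  rw [sub_mulVec, sub_mulVec, dotProduct_sub, dotProduct_sub, h1, h1, h3] at key
  have := congrArg Complex.im key
  rw [Complex.sub_im, Complex.sub_im, h2 (actNum M τ *ᵥ v), h2 (τ *ᵥ v)] at this
  linarith

theorem isUnit_det_autFactor (M : Sp g) {τ : Matrix (Fin g) (Fin g) ℂ}
    (hτ : τ ∈ SiegelUpperHalf g) : IsUnit (autFactor M τ).det := by
  rw [isUnit_iff_ne_zero]
  intro h0
  obtain ⟨v, hv, hv0⟩ := exists_mulVec_eq_zero_iff.2 h0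
  have h := (mem_siegelUpperHalf_iff.1 hτ).2 v hv
  rw [← star_dotProduct_actNum M, hv0] at h
  simp at h

theorem act_eq (M : Sp g) (τ : Matrix (Fin g) (Fin g) ℂ) :
    act M τ = actNum M τ * (autFactor M τ)⁻¹ := rfl

theorem act_mul_autFactor (M : Sp g) {τ : Matrix (Fin g) (Fin g) ℂ}
    (hτ : τ ∈ SiegelUpperHalf g) : act M τ * autFactor M τ = actNum M τ := by
  rw [act_eq, mul_assoc, nonsing_inv_mul _ (isUnit_det_autFactor M hτ), mul_one]

theorem act_transpose (M : Sp g) {τ : Matrix (Fin g) (Fin g) ℂ}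
    (hτ : τ ∈ SiegelUpperHalf g) : (act M τ)ᵀ = act M τ := by
  have hu := isUnit_det_autFactor M hτ
  have hu' : IsUnit (autFactor M τ)ᵀ.det := by rwa [det_transpose]
  have h := autFactor_transpose_mul_actNum M hτ.1
  rw [act_eq, transpose_mul, transpose_nonsing_inv]
  calc ((autFactor M τ)ᵀ)⁻¹ * (actNum M τ)ᵀ
      = ((autFactor M τ)ᵀ)⁻¹ * ((actNum M τ)ᵀ * autFactor M τ) * (autFactor M τ)⁻¹ := by
        rw [mul_assoc, mul_assoc, mul_nonsing_inv _ hu, mul_one]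
    _ = actNum M τ * (autFactor M τ)⁻¹ := by
        rw [← h, ← mul_assoc, nonsing_inv_mul _ hu', one_mul]

theorem act_mem (M : Sp g) {τ : Matrix (Fin g) (Fin g) ℂ}
    (hτ : τ ∈ SiegelUpperHalf g) : act M τ ∈ SiegelUpperHalf g := by
  rw [mem_siegelUpperHalf_iff]
  refine ⟨act_transpose M hτ, fun v hv => ?_⟩
  have hu := isUnit_det_autFactor M hτ
  have hw : v = autFactor M τ *ᵥ ((autFactor M τ)⁻¹ *ᵥ v) := by
    rw [mulVec_mulVec, mul_nonsing_inv _ hu, one_mulVec]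
  have hw0 : (autFactor M τ)⁻¹ *ᵥ v ≠ 0 := by
    intro h0; rw [h0, mulVec_zero] at hw; exact hv hw
  have h := (mem_siegelUpperHalf_iff.1 hτ).2 _ hw0
  rwa [← star_dotProduct_actNum M, ← hw, mulVec_mulVec, ← act_eq] at h

theorem autFactor_mul (M N : Sp g) {τ : Matrix (Fin g) (Fin g) ℂ} (hτ : τ ∈ SiegelUpperHalf g) :
    autFactor (M * N) τ = autFactor M (act N τ) * autFactor N τ := by
  obtain ⟨-, -, hc, hd⟩ := blk_mul M N
  rw [autFactor, autFactor, add_mul, mul_assoc, act_mul_autFactor N hτ, hc, hd]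
  simp only [toC_add, toC_mul, actNum, autFactor]
  noncomm_ring

theorem actNum_mul (M N : Sp g) {τ : Matrix (Fin g) (Fin g) ℂ} (hτ : τ ∈ SiegelUpperHalf g) :
    actNum (M * N) τ = actNum M (act N τ) * autFactor N τ := by
  obtain ⟨ha, hb, -, -⟩ := blk_mul M N
  rw [actNum, actNum, add_mul, mul_assoc, act_mul_autFactor N hτ, ha, hb]
  simp only [toC_add, toC_mul, actNum, autFactor]
  noncomm_ring

theorem act_mul (M N : Sp g) {τ : Matrix (Fin g) (Fin g) ℂ} (hτ : τ ∈ SiegelUpperHalf g) :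
    act (M * N) τ = act M (act N τ) := by
  rw [act_eq, actNum_mul M N hτ, autFactor_mul M N hτ, Matrix.mul_inv_rev, act_eq M, ← mul_assoc,
    mul_assoc (actNum M _), mul_nonsing_inv _ (isUnit_det_autFactor N hτ), mul_one]

theorem autFactor_one (τ : Matrix (Fin g) (Fin g) ℂ) : autFactor 1 τ = 1 := by
  simp [autFactor, blk_one, toC_one, toC_zero]

theorem act_one (τ : Matrix (Fin g) (Fin g) ℂ) : act 1 τ = τ := by
  rw [act_eq, autFactor_one]
  simp [actNum, blk_one, toC_one, toC_zero]

/-- `ᵗ(cτ + d)⁻¹ = a - (Mτ)c`. -/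
theorem autFactor_inv_transpose (M : Sp g) {τ : Matrix (Fin g) (Fin g) ℂ}
    (hτ : τ ∈ SiegelUpperHalf g) :
    ((autFactor M τ)⁻¹)ᵀ = toC (blkA M) - act M τ * toC (blkC M) := by
  have hu' : IsUnit (autFactor M τ)ᵀ.det := by
    rw [det_transpose]; exact isUnit_det_autFactor M hτ
  have h1 : (autFactor M τ)ᵀ * act M τ = (actNum M τ)ᵀ := by
    rw [← act_mul_autFactor M hτ, transpose_mul, act_transpose M hτ]
  rw [transpose_nonsing_inv]
  refine inv_eq_right_inv ?_
  rw [mul_sub, ← mul_assoc, h1]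
  obtain ⟨r1, r2, r3, r4⟩ := toC_relations M
  simp only [autFactor, actNum, transpose_add, transpose_mul, hτ.1]
  linear_combination (norm := noncomm_ring) r4 - τ * r1

theorem continuous_autFactor (M : Sp g) : Continuous (autFactor M) := by
  unfold autFactor
  fun_prop

theorem continuousOn_act (M : Sp g) : ContinuousOn (act M) (SiegelUpperHalf g) := by
  intro τ hτ
  have hu : (autFactor M τ).det ≠ 0 := (isUnit_det_autFactor M hτ).ne_zero
  have hinv : ContinuousAt (fun τ => (autFactor M τ)⁻¹) τ := by
    simp only [inv_def, Ring.inverse_eq_inv']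
    exact ((continuous_autFactor M).matrix_det.continuousAt.inv₀ hu).smul
      (continuous_autFactor M).matrix_adjugate.continuousAt
  have hnum : Continuous (fun τ => toC (blkA M) * τ + toC (blkB M)) := by fun_prop
  exact (hnum.continuousAt.mul hinv).continuousWithinAt

end HalfSpace

/-! ### Convergence of theta series -/

section Convergence

theorem summable_prod_apply {n : ℕ} {f : ℤ → ℝ} (hf : Summable f) (h0 : ∀ k, 0 ≤ f k) :
    Summable fun p : Fin n → ℤ => ∏ i, f (p i) := by
  induction n with
  | zero => exact Summable.of_finite
  | succ n ih =>
    rw [← (Fin.consEquiv fun _ : Fin (n + 1) => ℤ).summable_iff]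
    refine (hf.mul_of_nonneg ih h0 fun p => Finset.prod_nonneg fun i _ => h0 _).congr ?_
    rintro ⟨a, p⟩
    simp [Fin.prod_univ_succ, Fin.consEquiv]

variable {g : ℕ}

/-- By homogeneity it is enough to take the minimum over the compact unit sphere. -/
theorem exists_quadratic_lower_bound {Y : Matrix (Fin g) (Fin g) ℝ} (hY : Y.PosDef) :
    ∃ δ : ℝ, 0 < δ ∧ ∀ x : Fin g → ℝ, δ * ∑ i, x i ^ 2 ≤ x ⬝ᵥ (Y *ᵥ x) := by
  have hp : ∀ x : Fin g → ℝ, x ≠ 0 → 0 < x ⬝ᵥ (Y *ᵥ x) := fun x hx => by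
    simpa using hY.dotProduct_mulVec_pos hx
  have hc : Continuous fun x : Fin g → ℝ => x ⬝ᵥ (Y *ᵥ x) := by fun_prop
  obtain ⟨ε, hε, hεs⟩ : ∃ ε : ℝ, 0 < ε ∧ ∀ x ∈ Metric.sphere (0 : Fin g → ℝ) 1,
      ε ≤ x ⬝ᵥ (Y *ᵥ x) := by
    rcases (Metric.sphere (0 : Fin g → ℝ) 1).eq_empty_or_nonempty with hemp | hne
    · exact ⟨1, one_pos, by simp [hemp]⟩
    · obtain ⟨x₀, hx₀, hmin⟩ := (isCompact_sphere (0 : Fin g → ℝ) 1).exists_isMinOn hne hc.continuousOn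
      refine ⟨_, hp x₀ ?_, fun x hx => hmin hx⟩
      rintro rfl
      simp at hx₀
  -- The sphere is that of the sup norm, where the sum of squares is at most `g‖x‖²`; `g + 1` keeps
  -- the denominator nonzero for `g = 0`.
  refine ⟨ε / (g + 1), by positivity, fun x => ?_⟩
  by_cases hx : x = 0
  · simp [hx]
  have hn : 0 < ‖x‖ := norm_pos_iff.2 hx
  have h1 := hεs (‖x‖⁻¹ • x) (by simp [norm_smul, hn.ne'])
  rw [mulVec_smul, smul_dotProduct, dotProduct_smul, smul_eq_mul, smul_eq_mul] at h1
  have h2 : ε * ‖x‖ ^ 2 ≤ x ⬝ᵥ (Y *ᵥ x) := by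
    calc ε * ‖x‖ ^ 2 ≤ (‖x‖⁻¹ * (‖x‖⁻¹ * x ⬝ᵥ (Y *ᵥ x))) * ‖x‖ ^ 2 := by gcongr
      _ = _ := by field_simp
  have h3 : ∑ i, x i ^ 2 ≤ (g + 1) * ‖x‖ ^ 2 := by
    calc ∑ i, x i ^ 2 ≤ ∑ _i : Fin g, ‖x‖ ^ 2 := by
          refine Finset.sum_le_sum fun i _ => ?_
          rw [← sq_abs]
          exact pow_le_pow_left₀ (abs_nonneg _) (norm_le_pi_norm x i) 2
      _ = g * ‖x‖ ^ 2 := by simp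
      _ ≤ _ := by nlinarith [sq_nonneg ‖x‖]
  calc ε / (g + 1) * ∑ i, x i ^ 2 ≤ ε / (g + 1) * ((g + 1) * ‖x‖ ^ 2) := by gcongr
    _ = ε * ‖x‖ ^ 2 := by field_simp
    _ ≤ _ := h2

/-! ### The theta series of characteristic zero -/

/-- An integral vector as a complex vector. -/
def castV (p : Fin g → ℤ) : Fin g → ℂ := fun i => (p i : ℂ)

/-- The general term of the theta series of characteristic zero. -/
def thetaTerm (τ : Matrix (Fin g) (Fin g) ℂ) (z : Fin g → ℂ) (p : Fin g → ℤ) : ℂ :=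
  Complex.exp (Real.pi * Complex.I * (castV p ⬝ᵥ (τ *ᵥ castV p) + 2 * (castV p ⬝ᵥ z)))

/-- The theta function of characteristic zero. -/
def thetaZero (τ : Matrix (Fin g) (Fin g) ℂ) (z : Fin g → ℂ) : ℂ := ∑' p, thetaTerm τ z p

theorem norm_thetaTerm (τ : Matrix (Fin g) (Fin g) ℂ) (z : Fin g → ℂ) (p : Fin g → ℤ) :
    ‖thetaTerm τ z p‖ = Real.exp (-Real.pi * ((fun i => (p i : ℝ)) ⬝ᵥ
      ((τ.map Complex.im) *ᵥ fun i => (p i : ℝ)) + 2 * ∑ i, (p i : ℝ) * (z i).im)) := by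
  rw [thetaTerm, Complex.norm_exp]
  congr 1
  simp [castV, dotProduct, mulVec, Complex.mul_re, Finset.mul_sum]

/-- Bounding the quadratic form below by `δ ∑ p_i²` separates the variables, and the terms are
dominated by a product of one-variable Jacobi bounds. -/
theorem summable_thetaTerm {τ : Matrix (Fin g) (Fin g) ℂ} (hτ : τ ∈ SiegelUpperHalf g)
    (z : Fin g → ℂ) : Summable (thetaTerm τ z) := by
  obtain ⟨δ, hδ, hb⟩ := exists_quadratic_lower_bound hτ.2
  -- A single `K` above every `|Im z_i|` lets one bound serve all coordinates.
  obtain ⟨K, hK⟩ : ∃ K : ℝ, K = ∑ i, |(z i).im| := ⟨_, rfl⟩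
  have h1 := summable_pow_mul_jacobiTheta₂_term_bound K hδ 0
  simp only [pow_zero, one_mul] at h1
  refine Summable.of_norm_bounded (summable_prod_apply (n := g) h1 fun k => (Real.exp_pos _).le) ?_
  intro p
  rw [norm_thetaTerm, ← Real.exp_sum]
  apply Real.exp_le_exp.2
  rw [← Finset.mul_sum, neg_mul, neg_mul, neg_le_neg_iff]
  refine mul_le_mul_of_nonneg_left ?_ Real.pi_pos.le
  rw [Finset.sum_sub_distrib, ← Finset.mul_sum]
  have h2 := hb fun i => (p i : ℝ)
  have h3 : -∑ i, (p i : ℝ) * (z i).im ≤ ∑ i, K * |(p i : ℝ)| := by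
    rw [← Finset.sum_neg_distrib]
    refine Finset.sum_le_sum fun i _ => ?_
    calc -((p i : ℝ) * (z i).im) ≤ |(p i : ℝ) * (z i).im| := neg_le_abs _
      _ = |(z i).im| * |(p i : ℝ)| := by rw [abs_mul, mul_comm]
      _ ≤ K * |(p i : ℝ)| := by
        gcongr
        rw [hK]
        exact Finset.single_le_sum (f := fun i => |(z i).im|) (fun _ _ => abs_nonneg _)
          (Finset.mem_univ i)
  have h4 : ∑ i, 2 * K * |((p i : ℤ) : ℝ)| = 2 * ∑ i, K * |(p i : ℝ)| := by
    rw [Finset.mul_sum]; exact Finset.sum_congr rfl fun i _ => by ring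
  push_cast at *
  linarith

end Convergence

/-! ### Characteristics -/

section Characteristics

variable {g : ℕ}

/-- The complex vector `m'`. -/
def fstV (m : Characteristic g) : Fin g → ℂ := castV (m ∘ Sum.inl)

/-- The complex vector `m''`. -/
def sndV (m : Characteristic g) : Fin g → ℂ := castV (m ∘ Sum.inr)

theorem dotProduct_castV (p q : Fin g → ℤ) : castV p ⬝ᵥ castV q = ((p ⬝ᵥ q : ℤ) : ℂ) := by
  simp [castV, dotProduct]

theorem toC_mulVec_castV (X : Matrix (Fin g) (Fin g) ℤ) (p : Fin g → ℤ) :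
    toC X *ᵥ castV p = castV (X *ᵥ p) := by
  ext i
  simp [castV, toC, mulVec, dotProduct]

theorem castV_add (p q : Fin g → ℤ) : castV (p + q) = castV p + castV q := by
  ext i; simp [castV]

theorem dotProduct_mulVec_comm {τ : Matrix (Fin g) (Fin g) ℂ} (hτ : τᵀ = τ) (u v : Fin g → ℂ) :
    u ⬝ᵥ (τ *ᵥ v) = v ⬝ᵥ (τ *ᵥ u) := by
  rw [dotProduct_mulVec, ← mulVec_transpose, hτ, dotProduct_comm]

/-- Expanding the square about `p` turns the characteristic into a translation of `z` by a half
period. -/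
theorem theta_eq_thetaZero (m : Characteristic g) {τ : Matrix (Fin g) (Fin g) ℂ} (hτ : τᵀ = τ)
    (z : Fin g → ℂ) :
    theta m τ z = Complex.exp (Real.pi * Complex.I * (1 / 4 * (fstV m ⬝ᵥ (τ *ᵥ fstV m))
        + fstV m ⬝ᵥ z + 1 / 2 * (fstV m ⬝ᵥ sndV m)))
      * thetaZero τ (z + (1 / 2 : ℂ) • (τ *ᵥ fstV m + sndV m)) := by
  rw [theta, thetaZero, ← tsum_mul_left]
  congr 1
  ext p
  have hv : (fun i => (p i : ℂ) + (m (Sum.inl i) : ℂ) / 2) = castV p + (1 / 2 : ℂ) • fstV m := by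
    ext i; simp [castV, fstV]; ring
  have hz : (fun i => z i + (m (Sum.inr i) : ℂ) / 2) = z + (1 / 2 : ℂ) • sndV m := by
    ext i; simp [castV, sndV]; ring
  simp only [hv, hz]
  rw [thetaTerm, ← Complex.exp_add]
  congr 1
  simp only [mulVec_add, mulVec_smul, add_dotProduct, dotProduct_add, smul_dotProduct,
    dotProduct_smul, smul_eq_mul, smul_add]
  rw [dotProduct_mulVec_comm hτ (fstV m) (castV p)]
  ring

theorem exp_pi_mul_I_mul_two_int (k : ℤ) :
    Complex.exp (Real.pi * Complex.I * (2 * (k : ℂ))) = 1 := by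
  rw [Complex.exp_eq_one_iff]
  exact ⟨k, by ring⟩

/-- The shift by `n'` is absorbed by reindexing. The shift by `n''` multiplies each term by exp(2πi
ᵗ(p + n' + m'/2) n''), where only the half-integral part survives. -/
theorem theta_add_two_smul (m n : Characteristic g) (τ : Matrix (Fin g) (Fin g) ℂ)
    (z : Fin g → ℂ) :
    theta (m + (2 : ℤ) • n) τ z = Complex.exp (Real.pi * Complex.I *
      (((m ∘ Sum.inl) ⬝ᵥ (n ∘ Sum.inr) : ℤ) : ℂ)) * theta m τ z := by
  rw [theta, theta, ← tsum_mul_left]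
  refine Eq.trans ?_ ((Equiv.addRight (n ∘ Sum.inl)).tsum_eq _)
  congr 1
  ext p
  have hv : (fun i => (p i : ℂ) + (((m + (2 : ℤ) • n) (Sum.inl i) : ℤ) : ℂ) / 2)
      = castV (p + n ∘ Sum.inl) + (1 / 2 : ℂ) • fstV m := by
    ext i; simp [castV, fstV, -zsmul_eq_mul]; ring
  have hv' : (fun i => (((Equiv.addRight (n ∘ Sum.inl)) p i : ℤ) : ℂ) + (m (Sum.inl i) : ℂ) / 2)
      = castV (p + n ∘ Sum.inl) + (1 / 2 : ℂ) • fstV m := by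
    ext i; simp [castV, fstV]; ring
  have hz : (fun i => z i + (((m + (2 : ℤ) • n) (Sum.inr i) : ℤ) : ℂ) / 2)
      = (fun i => z i + (m (Sum.inr i) : ℂ) / 2) + sndV n := by
    ext i; simp [castV, sndV, -zsmul_eq_mul]; ring
  simp only [hv, hv', hz]
  have h1 : ∀ w : ℂ, w = w * Complex.exp (Real.pi * Complex.I *
      (2 * (((p + n ∘ Sum.inl) ⬝ᵥ (n ∘ Sum.inr) : ℤ) : ℂ))) := fun w => by
    rw [exp_pi_mul_I_mul_two_int, mul_one]
  rw [h1 (Complex.exp (Real.pi * Complex.I * (((m ∘ Sum.inl) ⬝ᵥ (n ∘ Sum.inr) : ℤ) : ℂ))),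
    ← Complex.exp_add, ← Complex.exp_add, ← dotProduct_castV, ← dotProduct_castV]
  congr 1
  simp only [dotProduct_add, add_dotProduct, smul_dotProduct, smul_eq_mul, sndV, fstV]
  ring

end Characteristics

/-! ### Symplectic transformations of theta functions -/

section Transform

variable {g : ℕ}

/-- `(cτ + d)⁻¹ c`. -/
def autQuot (M : Sp g) (τ : Matrix (Fin g) (Fin g) ℂ) : Matrix (Fin g) (Fin g) ℂ :=
  (autFactor M τ)⁻¹ * toC (blkC M)

theorem toC_blkC_mul_blkD_transpose (M : Sp g) :
    toC (blkC M) * (toC (blkD M))ᵀ = toC (blkD M) * (toC (blkC M))ᵀ := by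
  have h := SymplecticGroup.mem_iff.1 M.2
  rw [coe_eq_fromBlocks M, J, fromBlocks_transpose, fromBlocks_multiply, fromBlocks_multiply,
    fromBlocks_inj] at h
  simp only [mul_zero, mul_one, zero_add, add_zero, mul_neg, neg_mul] at h
  have h1 : blkC M * (blkD M)ᵀ = blkD M * (blkC M)ᵀ := by
    rw [← sub_eq_zero, ← neg_eq_zero, ← h.2.2.2]; abel
  rw [← toC_transpose, ← toC_transpose, ← toC_mul, ← toC_mul, h1]

theorem autQuot_mul_autFactor_transpose (M : Sp g) {τ : Matrix (Fin g) (Fin g) ℂ}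
    (hτ : τ ∈ SiegelUpperHalf g) :
    autQuot M τ * (autFactor M τ)ᵀ = (toC (blkC M))ᵀ := by
  have h : toC (blkC M) * (autFactor M τ)ᵀ = autFactor M τ * (toC (blkC M))ᵀ := by
    simp only [autFactor, transpose_add, transpose_mul, hτ.1, mul_add, add_mul,
      toC_blkC_mul_blkD_transpose, mul_assoc]
  rw [autQuot, mul_assoc, h, ← mul_assoc, nonsing_inv_mul _ (isUnit_det_autFactor M hτ), one_mul]

theorem autQuot_transpose (M : Sp g) {τ : Matrix (Fin g) (Fin g) ℂ}
    (hτ : τ ∈ SiegelUpperHalf g) : (autQuot M τ)ᵀ = autQuot M τ := by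
  have hu' : IsUnit (autFactor M τ)ᵀ.det := by
    rw [det_transpose]; exact isUnit_det_autFactor M hτ
  rw [autQuot, transpose_mul, ← autQuot_mul_autFactor_transpose M hτ, transpose_nonsing_inv,
    mul_assoc, mul_nonsing_inv _ hu', mul_one, autQuot]

/-- This additive cocycle rule makes the exponential factor multiplicative, hence `thetaGroup` a
group. -/
theorem autQuot_mul (M N : Sp g) {τ : Matrix (Fin g) (Fin g) ℂ} (hτ : τ ∈ SiegelUpperHalf g) :
    autQuot (M * N) τ = (autFactor N τ)⁻¹ * autQuot M (act N τ) * ((autFactor N τ)⁻¹)ᵀ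
      + autQuot N τ := by
  have hM := isUnit_det_autFactor M (act_mem N hτ)
  have h : toC (blkC (M * N)) = toC (blkC M) * ((autFactor N τ)⁻¹)ᵀ
      + autFactor M (act N τ) * toC (blkC N) := by
    rw [autFactor_inv_transpose N hτ, (blk_mul M N).2.2.1, autFactor]
    simp only [toC_add, toC_mul]
    noncomm_ring
  simp only [autQuot]
  rw [autFactor_mul M N hτ, h, Matrix.mul_inv_rev, mul_add]
  congr 1
  · simp only [mul_assoc]
  · rw [mul_assoc, ← mul_assoc _ (autFactor M _), nonsing_inv_mul _ hM, one_mul]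

/-- The exponential factor `e(½ ᵗz (cτ + d)⁻¹ c z)`. -/
def expFactor (M : Sp g) (τ : Matrix (Fin g) (Fin g) ℂ) (z : Fin g → ℂ) : ℂ :=
  e (1 / 2 * (z ⬝ᵥ (autQuot M τ *ᵥ z)))

theorem expFactor_eq (M : Sp g) (τ : Matrix (Fin g) (Fin g) ℂ) (z : Fin g → ℂ) :
    expFactor M τ z = Complex.exp (Real.pi * Complex.I * (z ⬝ᵥ (autQuot M τ *ᵥ z))) := by
  rw [expFactor, e]; congr 1; ring

theorem expFactor_mul (M N : Sp g) {τ : Matrix (Fin g) (Fin g) ℂ} (hτ : τ ∈ SiegelUpperHalf g)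
    (z : Fin g → ℂ) : expFactor (M * N) τ z =
      expFactor M (act N τ) (((autFactor N τ)⁻¹)ᵀ *ᵥ z) * expFactor N τ z := by
  rw [expFactor_eq, expFactor_eq, expFactor_eq, ← Complex.exp_add, autQuot_mul M N hτ, add_mulVec,
    dotProduct_add, ← mul_add]
  congr 3
  rw [← mulVec_mulVec, ← mulVec_mulVec, dotProduct_mulVec, ← mulVec_transpose]

theorem expFactor_one (τ : Matrix (Fin g) (Fin g) ℂ) (z : Fin g → ℂ) : expFactor 1 τ z = 1 := by
  simp [expFactor, autQuot, e, blk_one, toC_zero]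

theorem expFactor_zero (M : Sp g) (τ : Matrix (Fin g) (Fin g) ℂ) : expFactor M τ 0 = 1 := by
  simp [expFactor, e]

/-- `κ` is the factor of automorphy of the theta function of characteristic zero under `M`, a square
root of `det(cτ + d)` up to a root of unity. -/
structure IsThetaFactor (M : Sp g) (κ : Matrix (Fin g) (Fin g) ℂ → ℂ) : Prop where
  continuousOn : ContinuousOn κ (SiegelUpperHalf g)
  sq_eq : ∃ ζ : ℂ, ζ ^ 4 = 1 ∧ ∀ τ ∈ SiegelUpperHalf g, κ τ ^ 2 = ζ * (autFactor M τ).det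
  transform : ∀ τ ∈ SiegelUpperHalf g, ∀ z, thetaZero (act M τ) (((autFactor M τ)⁻¹)ᵀ *ᵥ z)
    = κ τ * expFactor M τ z * thetaZero τ z

theorem IsThetaFactor.ne_zero {M : Sp g} {κ : Matrix (Fin g) (Fin g) ℂ → ℂ}
    (h : IsThetaFactor M κ) {τ : Matrix (Fin g) (Fin g) ℂ} (hτ : τ ∈ SiegelUpperHalf g) :
    κ τ ≠ 0 := by
  obtain ⟨ζ, hζ, hs⟩ := h.sq_eq
  intro h0
  have h1 := hs τ hτ
  rw [h0] at h1
  have hζ0 : ζ ≠ 0 := by rintro rfl; simp at hζ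
  have := (isUnit_det_autFactor M hτ).ne_zero
  simp_all

theorem IsThetaFactor.mul {M N : Sp g} {κ μ : Matrix (Fin g) (Fin g) ℂ → ℂ}
    (hM : IsThetaFactor M κ) (hN : IsThetaFactor N μ) :
    IsThetaFactor (M * N) fun τ => κ (act N τ) * μ τ where
  continuousOn := (hM.continuousOn.comp (continuousOn_act N) fun _ h => act_mem N h).mul
    hN.continuousOn
  sq_eq := by
    obtain ⟨ζ, hζ, hs⟩ := hM.sq_eq
    obtain ⟨ξ, hξ, ht⟩ := hN.sq_eq
    refine ⟨ζ * ξ, by rw [mul_pow, hζ, hξ, one_mul], fun τ hτ => ?_⟩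
    rw [mul_pow, hs _ (act_mem N hτ), ht τ hτ, autFactor_mul M N hτ, det_mul]
    ring
  transform τ hτ z := by
    rw [act_mul M N hτ, autFactor_mul M N hτ, Matrix.mul_inv_rev, transpose_mul, ← mulVec_mulVec,
      hM.transform _ (act_mem N hτ), hN.transform τ hτ, expFactor_mul M N hτ]
    ring

theorem IsThetaFactor.inv {M : Sp g} {κ : Matrix (Fin g) (Fin g) ℂ → ℂ} (hM : IsThetaFactor M κ) :
    IsThetaFactor M⁻¹ fun τ => (κ (act M⁻¹ τ))⁻¹ where
  continuousOn := (hM.continuousOn.comp (continuousOn_act M⁻¹) fun _ h => act_mem M⁻¹ h).inv₀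
    fun τ hτ => hM.ne_zero (act_mem M⁻¹ hτ)
  sq_eq := by
    obtain ⟨ζ, hζ, hs⟩ := hM.sq_eq
    refine ⟨ζ⁻¹, by rw [inv_pow, hζ, inv_one], fun τ hτ => ?_⟩
    have h1 := autFactor_mul M M⁻¹ hτ
    rw [mul_inv_cancel, autFactor_one] at h1
    have h2 := congrArg Matrix.det h1
    rw [det_one, det_mul] at h2
    rw [inv_pow, hs _ (act_mem M⁻¹ hτ), _root_.mul_inv, eq_inv_of_mul_eq_one_left h2.symm]
    simp
  transform τ hτ z := by
    have hτ' := act_mem M⁻¹ hτ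
    have h1 := autFactor_mul M M⁻¹ hτ
    rw [mul_inv_cancel, autFactor_one] at h1
    have h2 : (autFactor M (act M⁻¹ τ))⁻¹ = autFactor M⁻¹ τ := inv_eq_right_inv h1.symm
    have h3 := hM.transform _ hτ' (((autFactor M⁻¹ τ)⁻¹)ᵀ *ᵥ z)
    rw [← act_mul M M⁻¹ hτ, mul_inv_cancel, act_one, mulVec_mulVec, h2, ← transpose_mul,
      nonsing_inv_mul _ (isUnit_det_autFactor M⁻¹ hτ), transpose_one, one_mulVec] at h3
    have h4 := expFactor_mul M M⁻¹ hτ z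
    rw [mul_inv_cancel, expFactor_one] at h4
    have h5 := hM.ne_zero hτ'
    rw [h3, mul_comm (κ _)]
    calc _ = 1 * thetaZero (act M⁻¹ τ) (((autFactor M⁻¹ τ)⁻¹)ᵀ *ᵥ z) := by rw [one_mul]
      _ = _ := by rw [h4]; field_simp

/-- The elements under which the theta function of characteristic zero is a modular form. -/
def thetaGroup (g : ℕ) : Subgroup (Sp g) where
  carrier := {M | ∃ κ, IsThetaFactor M κ}
  one_mem' := ⟨fun _ => 1, continuousOn_const, ⟨1, by simp, fun τ _ => by simp [autFactor_one]⟩,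
    fun τ _ z => by simp [act_one, autFactor_one, expFactor_one]⟩
  mul_mem' := fun ⟨_, hκ⟩ ⟨_, hμ⟩ => ⟨_, hκ.mul hμ⟩
  inv_mem' := fun ⟨_, hκ⟩ => ⟨_, hκ.inv⟩

theorem fstV_transpose_mulVec (M : Sp g) (m : Characteristic g) :
    fstV (M.1ᵀ *ᵥ m) = (toC (blkA M))ᵀ *ᵥ fstV m + (toC (blkC M))ᵀ *ᵥ sndV m := by
  rw [fstV, fstV, sndV, ← toC_transpose, ← toC_transpose, toC_mulVec_castV, toC_mulVec_castV,
    ← castV_add, coe_eq_fromBlocks M, fromBlocks_transpose, fromBlocks_mulVec]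
  rfl

theorem sndV_transpose_mulVec (M : Sp g) (m : Characteristic g) :
    sndV (M.1ᵀ *ᵥ m) = (toC (blkB M))ᵀ *ᵥ fstV m + (toC (blkD M))ᵀ *ᵥ sndV m := by
  rw [sndV, fstV, sndV, ← toC_transpose, ← toC_transpose, toC_mulVec_castV, toC_mulVec_castV,
    ← castV_add, coe_eq_fromBlocks M, fromBlocks_transpose, fromBlocks_mulVec]
  rfl

theorem fstV_dotProduct_sndV (m : Characteristic g) : fstV m ⬝ᵥ sndV m = (quad m : ℂ) :=
  dotProduct_castV _ _

/-- The half period of `m` at Mτ corresponds to that of `ᵗM m` at τ, so the law for characteristic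
zero applies at a translated point; the rest is bookkeeping of exponents. -/
theorem IsThetaFactor.theta {M : Sp g} {κ : Matrix (Fin g) (Fin g) ℂ → ℂ}
    (hM : IsThetaFactor M κ) (m : Characteristic g) {τ : Matrix (Fin g) (Fin g) ℂ}
    (hτ : τ ∈ SiegelUpperHalf g) (z : Fin g → ℂ) :
    SiegelTheta.theta m (act M τ) (((autFactor M τ)⁻¹)ᵀ *ᵥ z) =
      κ τ * expFactor M τ z * Complex.exp (Real.pi * Complex.I *
        (1 / 4 * ((quad m : ℂ) - quad (M.1ᵀ *ᵥ m)))) * SiegelTheta.theta (M.1ᵀ *ᵥ m) τ z := by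
  set D := autFactor M τ with hD
  have hu : IsUnit D.det := isUnit_det_autFactor M hτ
  have hu' : IsUnit Dᵀ.det := by rwa [det_transpose]
  set n := M.1ᵀ *ᵥ m with hn
  set y := act M τ *ᵥ fstV m + sndV m with hy
  set x := τ *ᵥ fstV n + sndV n with hx
  -- `x` and `y` are twice the half periods of `n` at τ and of `m` at Mτ.
  have hxy : x = Dᵀ *ᵥ y := by
    have h1 : Dᵀ * act M τ = τ * (toC (blkA M))ᵀ + (toC (blkB M))ᵀ := by
      rw [← act_transpose M hτ, ← transpose_mul, act_mul_autFactor M hτ, actNum, transpose_add,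
        transpose_mul, hτ.1]
    rw [hx, hy, mulVec_add, mulVec_mulVec, h1, fstV_transpose_mulVec, sndV_transpose_mulVec, hD,
      autFactor, transpose_add, transpose_mul, hτ.1]
    simp only [mulVec_add, add_mulVec, mulVec_mulVec]
    abel
  have hyx : (D⁻¹)ᵀ *ᵥ x = y := by
    rw [hxy, mulVec_mulVec, transpose_nonsing_inv, nonsing_inv_mul _ hu', one_mulVec]
  -- This evaluates the cross and square terms created by translating `z` in the exponential factor.
  have hGx : autQuot M τ *ᵥ x = fstV n - D⁻¹ *ᵥ fstV m := by
    have h1 : D⁻¹ = (toC (blkA M))ᵀ - (toC (blkC M))ᵀ * act M τ := by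
      rw [← transpose_transpose D⁻¹, autFactor_inv_transpose M hτ, transpose_sub, transpose_mul,
        act_transpose M hτ]
    rw [hxy, mulVec_mulVec, autQuot_mul_autFactor_transpose M hτ, h1, fstV_transpose_mulVec, hy]
    simp only [mulVec_add, sub_mulVec, mulVec_mulVec]
    abel
  have hw : (D⁻¹)ᵀ *ᵥ z + (1 / 2 : ℂ) • y = (D⁻¹)ᵀ *ᵥ (z + (1 / 2 : ℂ) • x) := by
    rw [mulVec_add, mulVec_smul, hyx]
  rw [theta_eq_thetaZero m (act_transpose M hτ), theta_eq_thetaZero n hτ.1, ← hy, ← hx, hw,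
    hM.transform τ hτ, expFactor_eq, expFactor_eq]
  have hexp : ∀ a b c d f t k : ℂ, a + b = c + d + f → Complex.exp (Real.pi * Complex.I * a) *
      (k * Complex.exp (Real.pi * Complex.I * b) * t) = k * Complex.exp (Real.pi * Complex.I * c) *
      Complex.exp (Real.pi * Complex.I * d) * (Complex.exp (Real.pi * Complex.I * f) * t) := by
    intro a b c d f t k h
    have : Complex.exp (Real.pi * Complex.I * a) * Complex.exp (Real.pi * Complex.I * b) =
        Complex.exp (Real.pi * Complex.I * c) * Complex.exp (Real.pi * Complex.I * d) *
        Complex.exp (Real.pi * Complex.I * f) := by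
      rw [← Complex.exp_add, ← Complex.exp_add, ← Complex.exp_add, ← mul_add, ← mul_add, ← mul_add,
        h]
    linear_combination k * t * this
  apply hexp
  have e1 : fstV m ⬝ᵥ ((D⁻¹)ᵀ *ᵥ z) = z ⬝ᵥ (D⁻¹ *ᵥ fstV m) := by
    rw [mulVec_transpose, dotProduct_comm, ← dotProduct_mulVec]
  have e2 : x ⬝ᵥ (D⁻¹ *ᵥ fstV m) = fstV m ⬝ᵥ y := by
    rw [← hyx, mulVec_transpose, dotProduct_comm (fstV m), ← dotProduct_mulVec]
  have e3 : x ⬝ᵥ fstV n = fstV n ⬝ᵥ (τ *ᵥ fstV n) + fstV n ⬝ᵥ sndV n := by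
    rw [dotProduct_comm, hx, dotProduct_add]
  have e4 : fstV m ⬝ᵥ y = fstV m ⬝ᵥ (act M τ *ᵥ fstV m) + fstV m ⬝ᵥ sndV m := by
    rw [hy, dotProduct_add]
  rw [← fstV_dotProduct_sndV, ← fstV_dotProduct_sndV]
  simp only [mulVec_add, mulVec_smul, add_dotProduct, dotProduct_add, smul_dotProduct,
    dotProduct_smul, smul_eq_mul]
  rw [dotProduct_mulVec_comm (autQuot_transpose M hτ) x z, hGx, dotProduct_sub, dotProduct_sub, e1,
    e2, e3, e4, dotProduct_comm z (fstV n)]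
  ring

end Transform

/-! ### Theta transformation under the generators -/

section ThetaGenerators

variable {g : ℕ}

/-- Substituting `p ↦ ᵗa p` permutes the lattice and identifies the two series. -/
theorem mem_thetaGroup_of_blockDiagonal {M : Sp g} (hb : blkB M = 0) (hc : blkC M = 0) :
    M ∈ thetaGroup g := by
  obtain ⟨-, -, h3, -⟩ := blk_relations M
  rw [hc, transpose_zero, zero_mul, sub_zero] at h3
  have h3' : blkD M * (blkA M)ᵀ = 1 := mul_eq_one_comm.1 h3
  have hD : ∀ τ, autFactor M τ = toC (blkD M) := fun τ => by
    rw [autFactor, hc, toC_zero, zero_mul, zero_add]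
  have hinv : (toC (blkD M))⁻¹ = (toC (blkA M))ᵀ := by
    refine inv_eq_left_inv ?_
    rw [← toC_transpose, ← toC_mul, h3, toC_one]
  have hdet : (toC (blkD M)).det ^ 2 = 1 := by
    have h : toC (blkD M) = (Int.castRingHom ℂ).mapMatrix (blkD M) := rfl
    rw [h, ← RingHom.map_det, ← map_pow]
    have hu : IsUnit (blkD M).det := by
      rw [← isUnit_iff_isUnit_det]
      exact IsUnit.of_mul_eq_one _ h3'
    rcases Int.isUnit_iff.1 hu with h | h <;> simp [h]
  let E : (Fin g → ℤ) ≃ (Fin g → ℤ) :=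
    { toFun := fun p => (blkA M)ᵀ *ᵥ p
      invFun := fun p => blkD M *ᵥ p
      left_inv := fun p => by simp [mulVec_mulVec, h3']
      right_inv := fun p => by simp [mulVec_mulVec, h3] }
  -- With κ = 1 the root of unity must be `det d = ±1`.
  refine ⟨fun _ => 1, continuousOn_const, ⟨(toC (blkD M)).det, ?_, fun τ _ => ?_⟩, ?_⟩
  · rw [show 4 = 2 * 2 from rfl, pow_mul, hdet, one_pow]
  · rw [hD, one_pow, ← sq, hdet]
  · intro τ _ z
    have h1 : expFactor M τ z = 1 := by simp [expFactor, autQuot, hc, toC_zero, e]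
    have h2 : act M τ = toC (blkA M) * τ * (toC (blkA M))ᵀ := by
      rw [act, hb, toC_zero, add_zero, hD, hinv]
    rw [h1, hD, hinv, h2, one_mul, one_mul, transpose_transpose, thetaZero, thetaZero]
    refine Eq.trans ?_ (E.tsum_eq _)
    congr 1
    ext p
    have h4 : castV (E p) = (toC (blkA M))ᵀ *ᵥ castV p := by
      rw [← toC_transpose, toC_mulVec_castV]; rfl
    rw [thetaTerm, thetaTerm, h4, ← mulVec_mulVec, ← mulVec_mulVec, dotProduct_mulVec,
      dotProduct_mulVec (castV p), mulVec_transpose]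

theorem A_mem_thetaGroup (i j : Fin g) : A i j ∈ thetaGroup g :=
  mem_thetaGroup_of_blockDiagonal (by simp [A, blkB]) (by simp [A, blkC])

/-- All entries of `genB` are even, so the translation changes every exponent by a multiple of 2πi.
-/
theorem B_mem_thetaGroup (i j : Fin g) : B i j ∈ thetaGroup g := by
  have ha : blkA (B i j) = 1 := by simp [B, blkA]
  have hb : blkB (B i j) = genB i j := by simp [B, blkB]
  have hc : blkC (B i j) = 0 := by simp [B, blkC]
  have hd : blkD (B i j) = 1 := by simp [B, blkD]
  have hD : ∀ τ, autFactor (B i j) τ = 1 := fun τ => by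
    rw [autFactor, hc, hd, toC_zero, zero_mul, zero_add, toC_one]
  refine ⟨fun _ => 1, continuousOn_const, ⟨1, by simp, fun τ _ => by simp [hD]⟩, fun τ _ z => ?_⟩
  have h1 : expFactor (B i j) τ z = 1 := by simp [expFactor, autQuot, hc, toC_zero, e]
  have h2 : act (B i j) τ = τ + toC (genB i j) := by
    rw [act, ha, hb, hD, toC_one, one_mul, inv_one, mul_one]
  rw [h1, hD, h2, inv_one, transpose_one, one_mulVec, one_mul, one_mul, thetaZero, thetaZero]
  congr 1
  ext p
  obtain ⟨k, hk⟩ : ∃ k : ℤ, p ⬝ᵥ (genB i j *ᵥ p) = 2 * k := by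
    have h : genB i j = (2 : ℤ) • of fun k l => if (k = i ∧ l = j) ∨ (k = j ∧ l = i) then 1 else 0 := by
      ext k l
      simp only [genB, of_apply, Matrix.smul_apply, smul_eq_mul]
      split_ifs <;> rfl
    rw [h, smul_mulVec, dotProduct_smul, smul_eq_mul]
    exact ⟨_, rfl⟩
  rw [thetaTerm, thetaTerm, add_mulVec, dotProduct_add, toC_mulVec_castV, dotProduct_castV, hk,
    ← mul_one (Complex.exp (_ * (castV p ⬝ᵥ (τ *ᵥ castV p) + 2 * (castV p ⬝ᵥ z)))),
    ← exp_pi_mul_I_mul_two_int k, ← Complex.exp_add]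
  congr 1
  push_cast
  ring

/-- The unipotent element used to derive `C_{ij}` from `C_{ii}` and `C_{jj}`. -/
def unipotent {i j : Fin g} (h : i ≠ j) : Sp g :=
  ⟨fromBlocks (1 - single i j 1) 0 0 (1 + single j i 1), by
    rw [SymplecticGroup.mem_iff, J, fromBlocks_multiply, fromBlocks_transpose, fromBlocks_multiply]
    simp [mul_sub, sub_mul, mul_add, add_mul, h, h.symm]
    abel⟩

/-- Conjugation replaces the form `2x_i²` by `2(x_i + x_j)²`, whose cross term is `C i j`. -/
theorem C_mul_unipotent {i j : Fin g} (h : i ≠ j) :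
    C i j * C j j * C i i * unipotent h = unipotent h * C i i := by
  have hC : ∀ i j : Fin g, (C i j).1 = fromBlocks 1 0 (genB i j) 1 := by
    intro i j
    simp [C, B, fromBlocks_transpose, genB_transpose]
  apply Subtype.ext
  simp only [Submonoid.coe_mul, hC, unipotent, fromBlocks_multiply, genB_of_ne h, genB_self]
  simp [mul_sub, add_mul, h.symm]
  abel

/-- The conjugating element is not in Γ_g(2), but it is block diagonal and so belongs to the larger
`thetaGroup`. -/
theorem C_mem_thetaGroup_of_self (hC : ∀ i : Fin g, C i i ∈ thetaGroup g) (i j : Fin g) :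
    C i j ∈ thetaGroup g := by
  by_cases h : i = j
  · subst h; exact hC i
  have hu : unipotent h ∈ thetaGroup g :=
    mem_thetaGroup_of_blockDiagonal (by simp [unipotent, blkB]) (by simp [unipotent, blkC])
  have h1 : C i j * C j j * C i i * unipotent h ∈ thetaGroup g := by
    rw [C_mul_unipotent h]
    exact mul_mem hu (hC i)
  rw [Subgroup.mul_mem_cancel_right _ hu, Subgroup.mul_mem_cancel_right _ (hC i),
    Subgroup.mul_mem_cancel_right _ (hC j)] at h1
  exact h1

/-! #### The one-variable transformation -/

/-- The factor of automorphy of the Jacobi theta function under `τ ↦ τ / (2τ + 1)`. -/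
def jacobiFactor (t : ℂ) : ℂ :=
  (-Complex.I * t) ^ (1 / 2 : ℂ) / (-Complex.I * (t / (2 * t + 1))) ^ (1 / 2 : ℂ)

theorem two_mul_add_one_ne_zero {t : ℂ} (ht : 0 < t.im) : 2 * t + 1 ≠ 0 := by
  intro h
  have := congrArg Complex.im h
  simp at this
  exact ht.ne' this

theorem ne_zero_of_im_pos {t : ℂ} (ht : 0 < t.im) : t ≠ 0 := by
  rintro rfl; simp at ht

theorem im_div_two_mul_add_one {t : ℂ} (ht : 0 < t.im) : 0 < (t / (2 * t + 1)).im := by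
  have h := two_mul_add_one_ne_zero ht
  have hn : 0 < Complex.normSq (2 * t + 1) := Complex.normSq_pos.2 h
  rw [Complex.div_im, ← sub_div]
  apply div_pos _ hn
  simp
  nlinarith

theorem jacobiFactor_sq {t : ℂ} (ht : 0 < t.im) : jacobiFactor t ^ 2 = 2 * t + 1 := by
  have hpow : ∀ w : ℂ, (w ^ (1 / 2 : ℂ)) ^ 2 = w := fun w => by
    rw [← Complex.cpow_nat_mul]; simp
  have h := two_mul_add_one_ne_zero ht
  have h0 := ne_zero_of_im_pos ht
  rw [jacobiFactor, div_pow, hpow, hpow]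
  field_simp [Complex.I_ne_zero]

/-- Multiplication by `-i` maps the upper half-plane to the right half-plane, away from the cut of
the principal root. -/
theorem continuousAt_jacobiFactor {t : ℂ} (ht : 0 < t.im) : ContinuousAt jacobiFactor t := by
  have h := two_mul_add_one_ne_zero ht
  have h1 := im_div_two_mul_add_one ht
  have hslit : ∀ w : ℂ, 0 < w.im → -Complex.I * w ∈ Complex.slitPlane := by
    intro w hw
    left
    simpa using hw
  have hne : ∀ w : ℂ, 0 < w.im → (-Complex.I * w) ^ (1 / 2 : ℂ) ≠ 0 := by
    intro w hw h0
    rw [Complex.cpow_eq_zero_iff] at h0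
    have := ne_zero_of_im_pos hw
    simp_all
  have hq : ContinuousAt (fun t : ℂ => t / (2 * t + 1)) t := by
    refine continuousAt_id.div (by fun_prop) h
  exact ((continuousAt_const.mul continuousAt_id).cpow continuousAt_const (hslit _ ht)).div
    ((continuousAt_const.mul hq).cpow continuousAt_const (hslit _ h1)) (hne _ h1)

/-- Since -1/(t/(2t+1)) = -1/t - 2, inverting at both points reduces the claim to periodicity under
a shift by 2. -/
theorem jacobiTheta₂_div_two_mul_add_one (w : ℂ) {t : ℂ} (ht : 0 < t.im) :
    jacobiTheta₂ (w / (2 * t + 1)) (t / (2 * t + 1)) =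
      jacobiFactor t * Complex.exp (Real.pi * Complex.I * (2 * w ^ 2 / (2 * t + 1)))
        * jacobiTheta₂ w t := by
  have h := two_mul_add_one_ne_zero ht
  have h0 := ne_zero_of_im_pos ht
  have h1 := im_div_two_mul_add_one ht
  have h10 := ne_zero_of_im_pos h1
  have hne : (-Complex.I * t) ^ (1 / 2 : ℂ) ≠ 0 := by
    intro h0'
    rw [Complex.cpow_eq_zero_iff] at h0'
    simp_all
  rw [jacobiTheta₂_functional_equation (w / (2 * t + 1)), jacobiTheta₂_functional_equation w t,
    ← jacobiTheta₂_add_right (w / (2 * t + 1) / (t / (2 * t + 1)))]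
  have e1 : w / (2 * t + 1) / (t / (2 * t + 1)) = w / t := by field_simp
  have e2 : -1 / (t / (2 * t + 1)) + 2 = -1 / t := by field_simp; ring
  have e3 : Complex.exp (-Real.pi * Complex.I * (w / (2 * t + 1)) ^ 2 / (t / (2 * t + 1)))
      = Complex.exp (Real.pi * Complex.I * (2 * w ^ 2 / (2 * t + 1)))
        * Complex.exp (-Real.pi * Complex.I * w ^ 2 / t) := by
    rw [← Complex.exp_add]
    congr 1
    field_simp
    ring
  rw [e1, e2, e3, jacobiFactor]
  field_simp

end ThetaGenerators

/-! ### The elements `C i i`, by splitting the lattice sum along one coordinate -/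

section SplitCoordinate

variable {g : ℕ}

/-- Extension by zero at the coordinate `i`. -/
def extendZero (i : Fin g) (q : {j : Fin g // j ≠ i} → ℤ) : Fin g → ℤ :=
  (Equiv.funSplitAt i ℤ).symm (0, q)

theorem castV_funSplitAt_symm (i : Fin g) (t : ℤ) (q : {j : Fin g // j ≠ i} → ℤ) :
    castV ((Equiv.funSplitAt i ℤ).symm (t, q)) = castV (extendZero i q) + Pi.single i (t : ℂ) := by
  ext k
  by_cases h : k = i
  · subst h
    simp [castV, extendZero, Equiv.funSplitAt, Equiv.piSplitAt]
  · simp [castV, extendZero, Equiv.funSplitAt, Equiv.piSplitAt, h]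

theorem thetaTerm_funSplitAt_symm {τ : Matrix (Fin g) (Fin g) ℂ} (hτ : τᵀ = τ) (z : Fin g → ℂ)
    (i : Fin g) (t : ℤ) (q : {j : Fin g // j ≠ i} → ℤ) :
    thetaTerm τ z ((Equiv.funSplitAt i ℤ).symm (t, q)) = thetaTerm τ z (extendZero i q)
      * jacobiTheta₂_term t (z i + (τ *ᵥ castV (extendZero i q)) i) (τ i i) := by
  rw [thetaTerm, thetaTerm, jacobiTheta₂_term, ← Complex.exp_add, castV_funSplitAt_symm]
  congr 1
  have h1 : (Pi.single i (t : ℂ) : Fin g → ℂ) ⬝ᵥ (τ *ᵥ Pi.single i (t : ℂ)) = t ^ 2 * τ i i := by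
    simp [mulVec_single]; ring
  simp only [mulVec_add, add_dotProduct, dotProduct_add]
  rw [dotProduct_mulVec_comm hτ _ (Pi.single i (t : ℂ)), h1, single_dotProduct, single_dotProduct]
  ring

theorem im_diag_pos {τ : Matrix (Fin g) (Fin g) ℂ} (hτ : τ ∈ SiegelUpperHalf g) (i : Fin g) :
    0 < (τ i i).im := by
  have h := hτ.2.diag_pos (i := i)
  simpa using h

theorem thetaZero_eq_tsum_jacobiTheta₂ {τ : Matrix (Fin g) (Fin g) ℂ} (hτ : τ ∈ SiegelUpperHalf g)
    (z : Fin g → ℂ) (i : Fin g) :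
    thetaZero τ z = ∑' q : {j : Fin g // j ≠ i} → ℤ, thetaTerm τ z (extendZero i q)
      * jacobiTheta₂ (z i + (τ *ᵥ castV (extendZero i q)) i) (τ i i) := by
  let E : ({j : Fin g // j ≠ i} → ℤ) × ℤ ≃ (Fin g → ℤ) :=
    (Equiv.prodComm _ _).trans (Equiv.funSplitAt i ℤ).symm
  have hs : Summable fun x => thetaTerm τ z (E x) := E.summable_iff.2 (summable_thetaTerm hτ z)
  rw [thetaZero, ← E.tsum_eq, hs.tsum_prod]
  congr 1
  ext q
  rw [jacobiTheta₂, ← tsum_mul_left]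
  congr 1
  ext t
  exact thetaTerm_funSplitAt_symm hτ.1 z i t q

/-- `C i i` changes τ by a matrix of rank one. With the other coordinates fixed, the sum over
coordinate `i` is a Jacobi theta function, which undergoes `t ↦ t/(2t+1)`; its factor does not
depend on the fixed coordinates and comes out of the sum. -/
theorem C_self_mem_thetaGroup (i : Fin g) : C i i ∈ thetaGroup g := by
  have hM : (C i i).1 = fromBlocks 1 0 (genB i i) 1 := by
    simp [C, B, fromBlocks_transpose, genB_transpose]
  have ha : blkA (C i i) = 1 := by simp [blkA, hM]
  have hb : blkB (C i i) = 0 := by simp [blkB, hM]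
  have hc : toC (blkC (C i i)) = single i i 2 := by
    ext k l
    simp [blkC, hM, genB_self, toC, single_apply]
  have hd : blkD (C i i) = 1 := by simp [blkD, hM]
  have hD : ∀ τ, autFactor (C i i) τ = 1 + single i i 2 * τ := fun τ => by
    rw [autFactor, hc, hd, toC_one, add_comm]
  have hdet : ∀ τ, (autFactor (C i i) τ).det = 2 * τ i i + 1 := by
    intro τ
    -- Written as a column times a row, for the determinant of a rank-one perturbation of the
    -- identity.
    have h : single i i 2 * τ
        = replicateCol Unit (Pi.single i (2 : ℂ)) * replicateRow Unit (τ i) := by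
      ext k l
      rw [mul_apply (M := replicateCol Unit _)]
      by_cases hk : k = i
      · subst hk; simp
      · simp [hk]
    rw [hD, h, det_one_add_replicateCol_mul_replicateRow]
    simp
    ring
  refine ⟨fun τ => jacobiFactor (τ i i), ?_, ⟨1, by simp, fun τ hτ => ?_⟩, fun τ hτ z => ?_⟩
  · intro τ hτ
    have h : ContinuousAt (fun τ : Matrix (Fin g) (Fin g) ℂ => τ i i) τ :=
      (continuous_id.matrix_elem i i).continuousAt
    exact (ContinuousAt.comp (f := fun τ : Matrix (Fin g) (Fin g) ℂ => τ i i) (g := jacobiFactor)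
      (continuousAt_jacobiFactor (im_diag_pos hτ i)) h).continuousWithinAt
  · rw [jacobiFactor_sq (im_diag_pos hτ i), hdet, one_mul]
  have ht := im_diag_pos hτ i
  have hr := two_mul_add_one_ne_zero ht
  set r := 2 * τ i i + 1 with hrdef
  have h2 : single i i (2 : ℂ) = (2 : ℂ) • single i i 1 := by rw [smul_single, smul_eq_mul, mul_one]
  have hEE : single i i (1 : ℂ) * τ * single i i 1 = τ i i • single i i 1 := by
    ext k l
    by_cases hk : k = i
    · by_cases hl : l = i
      · simp [hk, hl]
      · simp [hk, hl, Ne.symm hl]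
    · simp [hk, Ne.symm hk, mul_assoc]
  have hinv : (autFactor (C i i) τ)⁻¹ = 1 - (2 / r) • (single i i 1 * τ) := by
    refine inv_eq_right_inv ?_
    have h3 : single i i (1 : ℂ) * τ * (single i i 1 * τ) = τ i i • (single i i 1 * τ) := by
      rw [← mul_assoc, hEE, smul_mul_assoc]
    rw [hD, h2, mul_sub, mul_one, add_mul, one_mul, smul_mul_assoc, smul_mul_assoc, mul_smul_comm,
      h3, smul_smul, smul_smul]
    have h4 : (2 : ℂ) * (2 / r) * τ i i = 2 - 2 / r := by
      rw [hrdef] at hr ⊢; field_simp; ring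
    rw [h4, sub_smul]
    abel
  have hquot : autQuot (C i i) τ = (2 / r) • single i i 1 := by
    rw [autQuot, hinv, hc, h2, sub_mul, one_mul, smul_mul_assoc, mul_smul_comm, hEE, smul_smul,
      smul_smul, ← sub_smul]
    congr 1
    rw [hrdef] at hr ⊢; field_simp; ring
  have hE : ∀ u : Fin g → ℂ, single i i (1 : ℂ) *ᵥ u = u i • Pi.single i 1 := by
    intro u
    ext k
    by_cases hk : k = i
    · subst hk; simp [mulVec, dotProduct, single_apply]
    · simp [mulVec, dotProduct, hk, Ne.symm hk]
  set s := τ *ᵥ Pi.single i (1 : ℂ) with hs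
  have hsi : s i = τ i i := by simp [hs]
  have hus : ∀ u : Fin g → ℂ, u ⬝ᵥ s = (τ *ᵥ u) i := by
    intro u
    rw [hs, dotProduct_mulVec_comm hτ.1, single_dotProduct, one_mul]
  have hact : act (C i i) τ = τ - (2 / r) • (τ * (single i i 1 * τ)) := by
    rw [act, ha, hb, toC_one, toC_zero, one_mul, add_zero, hinv, mul_sub, mul_one, mul_smul_comm]
  -- In these terms Mτ is τ minus `2/r` times `s ᵗs`.
  have hactV : ∀ v : Fin g → ℂ, act (C i i) τ *ᵥ v = τ *ᵥ v - (2 / r * (τ *ᵥ v) i) • s := by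
    intro v
    rw [hact, sub_mulVec, smul_mulVec, ← mulVec_mulVec, ← mulVec_mulVec, hE, mulVec_smul, smul_smul]
  have hinvT : ((autFactor (C i i) τ)⁻¹)ᵀ *ᵥ z = z - (2 / r * z i) • s := by
    rw [hinv, transpose_sub, transpose_one, transpose_smul, transpose_mul, hτ.1, transpose_single,
      sub_mulVec, one_mulVec, smul_mulVec, ← mulVec_mulVec, hE, mulVec_smul, smul_smul]
  have hdiv : ∀ w : ℂ, w - 2 / r * w * τ i i = w / r := by
    intro w; rw [hrdef] at hr ⊢; field_simp; ring
  have hactii : act (C i i) τ i i = τ i i / r := by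
    have h5 := congrFun (hactV (Pi.single i 1)) i
    rw [Pi.sub_apply, Pi.smul_apply, smul_eq_mul, ← hs, hsi, hdiv] at h5
    simpa using h5
  rw [thetaZero_eq_tsum_jacobiTheta₂ (act_mem _ hτ) _ i, thetaZero_eq_tsum_jacobiTheta₂ hτ z i,
    ← tsum_mul_left, expFactor_eq, hquot, hinvT]
  congr 1
  ext q
  set P := castV (extendZero i q) with hP
  have h6 : (z - (2 / r * z i) • s) i + (act (C i i) τ *ᵥ P) i = (z i + (τ *ᵥ P) i) / r := by
    rw [hactV, Pi.sub_apply, Pi.sub_apply, Pi.smul_apply, Pi.smul_apply, hsi, smul_eq_mul,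
      smul_eq_mul, hdiv, hdiv, add_div]
  rw [h6, hactii, hrdef, jacobiTheta₂_div_two_mul_add_one _ ht, ← hrdef, thetaTerm, thetaTerm, ← hP,
    hactV, dotProduct_sub, dotProduct_sub, dotProduct_smul, dotProduct_smul, hus, smul_mulVec, hE,
    dotProduct_smul, dotProduct_smul, dotProduct_single, smul_eq_mul, smul_eq_mul, smul_eq_mul,
    smul_eq_mul]
  have hexp : ∀ a b c d k t : ℂ, a + b = c + d → Complex.exp (Real.pi * Complex.I * a) *
      (k * Complex.exp (Real.pi * Complex.I * b) * t) = k * Complex.exp (Real.pi * Complex.I * c) *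
      (Complex.exp (Real.pi * Complex.I * d) * t) := by
    intro a b c d k t h
    have : Complex.exp (Real.pi * Complex.I * a) * Complex.exp (Real.pi * Complex.I * b) =
        Complex.exp (Real.pi * Complex.I * c) * Complex.exp (Real.pi * Complex.I * d) := by
      rw [← Complex.exp_add, ← Complex.exp_add, ← mul_add, ← mul_add, h]
    linear_combination k * t * this
  apply hexp
  field_simp
  ring

theorem Gamma2_le_thetaGroup : Gamma2 g ≤ thetaGroup g := by
  rw [← genGroup_eq, genGroup, Subgroup.closure_le]
  rintro _ ((⟨i, j, rfl⟩ | ⟨i, j, rfl⟩) | ⟨i, j, rfl⟩)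
  exacts [A_mem_thetaGroup i j, B_mem_thetaGroup i j,
    C_mem_thetaGroup_of_self C_self_mem_thetaGroup i j]

end SplitCoordinate

/-! ### The abelianization of `Γ_g(2)` -/

section Abelianization

variable {g : ℕ}

theorem orderedProd_mem {X : Fin g → Fin g → Sp g} (hX : ∀ i j, X i j ∈ Gamma2 g)
    (l : List (Fin g × Fin g)) (k : Fin g → Fin g → ℤ) : orderedProd l X k ∈ Gamma2 g := by
  refine Subgroup.list_prod_mem _ fun M hM => ?_
  obtain ⟨x, -, rfl⟩ := List.mem_map.1 hM
  exact zpow_mem (hX _ _) _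

theorem map_orderedProd {α : Type*} [CommGroup α] (f : Gamma2 g →* α) {X : Fin g → Fin g → Sp g}
    (hX : ∀ i j, X i j ∈ Gamma2 g) {l : List (Fin g × Fin g)} (hl : l.Nodup)
    (k : Fin g → Fin g → ℤ) :
    f ⟨orderedProd l X k, orderedProd_mem hX l k⟩
      = ∏ x ∈ l.toFinset, f ⟨X x.1 x.2, hX x.1 x.2⟩ ^ k x.1 x.2 := by
  rw [List.prod_toFinset _ hl]
  clear hl
  induction l with
  | nil => exact f.map_one
  | cons x l ih =>
    rw [List.map_cons, List.prod_cons, ← ih, ← map_zpow, ← map_mul]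
    rfl

theorem exists_eq_prod_zpow {l : List (Fin g × Fin g)} {x : Fin g × Fin g}
    (hx : x ∈ l) {α : Type*} [CommGroup α] (f : Fin g × Fin g → α) :
    ∃ k : Fin g → Fin g → ℤ, f x = ∏ y ∈ l.toFinset, f y ^ k y.1 y.2 := by
  refine ⟨fun i j => if (i, j) = x then 1 else 0, ?_⟩
  rw [Finset.prod_eq_single x]
  · simp
  · intro y _ hy
    simp [hy]
  · intro h
    exact absurd (List.mem_toFinset.2 hx) h

theorem B_comm (i j : Fin g) : B i j = B j i := by
  apply Subtype.ext
  simp only [B]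
  rw [← genB_transpose j i]
  congr 1
  ext k l
  simp [genB, and_comm]

theorem C_comm (i j : Fin g) : C i j = C j i := by
  apply Subtype.ext
  simp only [C, B_comm i j]

/-- In the abelianization the products of the required form make up a subgroup containing all
generators, whatever the orders of the factors; `M'` is the error on lifting back. -/
theorem exists_decomposition {lA lB lC : List (Fin g × Fin g)}
    (hA : Enumerates lA fun _ _ => True) (hB : Enumerates lB fun i j => i ≤ j)
    (hC : Enumerates lC fun i j => i ≤ j) {M : Sp g} (hM : M ∈ Gamma2 g) :
    ∃ p q r : Fin g → Fin g → ℤ, ∃ M' ∈ ⁅Gamma2 g, Gamma2 g⁆,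
      M = orderedProd lA A p * orderedProd lB B q * orderedProd lC C r * M' := by
  let f : Gamma2 g →* Abelianization (Gamma2 g) := Abelianization.of
  let fA : Fin g × Fin g → Abelianization (Gamma2 g) := fun x => f ⟨A x.1 x.2, A_mem_Gamma2 _ _⟩
  let fB : Fin g × Fin g → Abelianization (Gamma2 g) := fun x => f ⟨B x.1 x.2, B_mem_Gamma2 _ _⟩
  let fC : Fin g × Fin g → Abelianization (Gamma2 g) := fun x => f ⟨C x.1 x.2, C_mem_Gamma2 _ _⟩
  let S : Subgroup (Abelianization (Gamma2 g)) :=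
    { carrier := {x | ∃ p q r : Fin g → Fin g → ℤ, x = (∏ y ∈ lA.toFinset, fA y ^ p y.1 y.2) *
        (∏ y ∈ lB.toFinset, fB y ^ q y.1 y.2) * ∏ y ∈ lC.toFinset, fC y ^ r y.1 y.2}
      one_mem' := ⟨0, 0, 0, by simp⟩
      mul_mem' := by
        rintro _ _ ⟨p, q, r, rfl⟩ ⟨p', q', r', rfl⟩
        refine ⟨p + p', q + q', r + r', ?_⟩
        simp only [Pi.add_apply, _root_.zpow_add, Finset.prod_mul_distrib]
        rw [mul_mul_mul_comm, mul_mul_mul_comm (∏ y ∈ lA.toFinset, fA y ^ p y.1 y.2)]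
      inv_mem' := by
        rintro _ ⟨p, q, r, rfl⟩
        refine ⟨-p, -q, -r, ?_⟩
        simp only [Pi.neg_apply, _root_.zpow_neg, Finset.prod_inv_distrib, _root_.mul_inv] }
  have hS : ∀ N ∈ genGroup g, ∀ hN : N ∈ Gamma2 g, f ⟨N, hN⟩ ∈ S := by
    intro N hN
    refine Subgroup.closure_induction
      (p := fun N _ => ∀ hN : N ∈ Gamma2 g, f ⟨N, hN⟩ ∈ S) ?_ ?_ ?_ ?_ hN
    · rintro _ ((⟨i, j, rfl⟩ | ⟨i, j, rfl⟩) | ⟨i, j, rfl⟩) hmem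
      · obtain ⟨k, hk⟩ := exists_eq_prod_zpow ((hA.2 (i, j)).2 trivial) fA
        exact ⟨k, 0, 0, by simpa using hk⟩
      · wlog hij : i ≤ j generalizing i j
        · have := this j i (B_mem_Gamma2 j i) (le_of_not_ge hij)
          simpa only [B_comm i j] using this
        obtain ⟨k, hk⟩ := exists_eq_prod_zpow ((hB.2 (i, j)).2 hij) fB
        exact ⟨0, k, 0, by simpa using hk⟩
      · wlog hij : i ≤ j generalizing i j
        · have := this j i (C_mem_Gamma2 j i) (le_of_not_ge hij)
          simpa only [C_comm i j] using this
        obtain ⟨k, hk⟩ := exists_eq_prod_zpow ((hC.2 (i, j)).2 hij) fC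
        exact ⟨0, 0, k, by simpa using hk⟩
    · intro h
      have : f ⟨1, h⟩ = 1 := f.map_one
      rw [this]; exact one_mem S
    · intro x y hx hy ihx ihy h
      have hx' := genGroup_le hx
      have hy' := genGroup_le hy
      have : f ⟨x * y, h⟩ = f ⟨x, hx'⟩ * f ⟨y, hy'⟩ := f.map_mul ⟨x, hx'⟩ ⟨y, hy'⟩
      rw [this]; exact mul_mem (ihx hx') (ihy hy')
    · intro x hx ihx h
      have hx' := genGroup_le hx
      have : f ⟨x⁻¹, h⟩ = (f ⟨x, hx'⟩)⁻¹ := f.map_inv ⟨x, hx'⟩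
      rw [this]; exact inv_mem (ihx hx')
  obtain ⟨p, q, r, h⟩ := hS M (genGroup_eq (g := g) ▸ hM) hM
  let P : Gamma2 g := ⟨orderedProd lA A p, orderedProd_mem A_mem_Gamma2 _ _⟩ *
    ⟨orderedProd lB B q, orderedProd_mem B_mem_Gamma2 _ _⟩ *
    ⟨orderedProd lC C r, orderedProd_mem C_mem_Gamma2 _ _⟩
  have hP : f P = f ⟨M, hM⟩ := by
    rw [h, map_mul, map_mul, map_orderedProd f _ hA.1, map_orderedProd f _ hB.1,
      map_orderedProd f _ hC.1]
  refine ⟨p, q, r, P.1⁻¹ * M, ?_, ?_⟩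
  · rw [← Subgroup.map_subtype_commutator]
    refine ⟨P⁻¹ * ⟨M, hM⟩, ?_, rfl⟩
    rw [← Abelianization.ker_of, SetLike.mem_coe, MonoidHom.mem_ker]
    change f (P⁻¹ * ⟨M, hM⟩) = 1
    rw [map_mul, map_inv, hP, inv_mul_cancel]
  · change M = P.1 * (P.1⁻¹ * M)
    rw [mul_inv_cancel_left]

/-! ### Values of the character -/

theorem chiExp_A (m : Characteristic g) (i j : Fin g) :
    (chiExp m (A i j) : ZMod 4) = 2 * (m (Sum.inl i) * m (Sum.inr j) : ℤ) := by
  by_cases h : i = j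
  · subst h
    have hX : (A i i).1 = 1 + (2 : ℤ) •
        diagonal (fun x => if x = Sum.inl i ∨ x = Sum.inr i then (-1 : ℤ) else 0) := by
      rw [coe_A_self, ← diagonal_one, ← diagonal_smul, diagonal_add]
      congr 1
      ext x
      simp only [Pi.smul_apply, smul_eq_mul]
      split_ifs <;> norm_num
    have h1 : chiExp m (A i i) = -2 * (m (Sum.inl i) * m (Sum.inr i)) := by
      rw [chiExp, halfDiff_eq hX]
      simp [symp, quad, dotProduct, mulVec_diagonal]
      ring
    rw [h1, ← sub_eq_zero]
    have h4 : (4 : ZMod 4) = 0 := rfl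
    push_cast
    linear_combination (-(m (Sum.inl i) : ZMod 4) * m (Sum.inr i)) * h4
  · have hX : (A i j).1 = 1 + (2 : ℤ) •
        (single (Sum.inl i) (Sum.inl j) 1 - single (Sum.inr j) (Sum.inr i) 1) := by
      rw [coe_A_of_ne h, smul_sub, smul_single, smul_single]
      rfl
    have h1 : chiExp m (A i j) = -2 * (m (Sum.inl i) * m (Sum.inr j)) := by
      rw [chiExp, halfDiff_eq hX]
      simp [symp, quad, dotProduct, mulVec, single_apply, ite_and, Ne.symm h]
      ring
    rw [h1, ← sub_eq_zero]
    have h4 : (4 : ZMod 4) = 0 := rfl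
    push_cast
    linear_combination (-(m (Sum.inl i) : ZMod 4) * m (Sum.inr j)) * h4

theorem chiExp_B (m : Characteristic g) (i j : Fin g) :
    chiExp m (B i j) = if i = j then m (Sum.inl i) * m (Sum.inl j) else
      2 * (m (Sum.inl i) * m (Sum.inl j)) := by
  by_cases h : i = j
  · subst h
    have hX : (B i i).1 = 1 + (2 : ℤ) • single (Sum.inl i) (Sum.inr i) 1 := by
      rw [coe_B_self, smul_single]
      rfl
    rw [chiExp, halfDiff_eq hX]
    simp [symp, quad, dotProduct, mulVec, single_apply, ite_and]
  · have hX : (B i j).1 = 1 + (2 : ℤ) •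
        (single (Sum.inl i) (Sum.inr j) 1 + single (Sum.inl j) (Sum.inr i) 1) := by
      rw [coe_B_of_ne h, smul_add, smul_single, smul_single]
      rfl
    rw [chiExp, halfDiff_eq hX, if_neg h]
    simp [symp, quad, dotProduct, mulVec, single_apply, add_mul, mul_add, Finset.sum_add_distrib,
      ite_and]
    ring

/-- The diagonal sign is opposite to that of `B i i`. Writing `1 = 2 - 1` there explains why the
`q`-sum in `expA` includes the diagonal and the `r`-sum does not. -/
theorem chiExp_C (m : Characteristic g) (i j : Fin g) :
    chiExp m (C i j) = if i = j then -(m (Sum.inr i) * m (Sum.inr j)) else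
      -2 * (m (Sum.inr i) * m (Sum.inr j)) := by
  by_cases h : i = j
  · subst h
    have hX : (C i i).1 = 1 + (2 : ℤ) • single (Sum.inr i) (Sum.inl i) 1 := by
      rw [coe_C_self, smul_single]
      rfl
    rw [chiExp, halfDiff_eq hX]
    simp [symp, quad, dotProduct, mulVec, single_apply, ite_and]
  · have hX : (C i j).1 = 1 + (2 : ℤ) •
        (single (Sum.inr j) (Sum.inl i) 1 + single (Sum.inr i) (Sum.inl j) 1) := by
      rw [coe_C_of_ne h, smul_add, smul_single, smul_single]
      rfl
    rw [chiExp, halfDiff_eq hX, if_neg h]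
    simp [symp, quad, dotProduct, mulVec, single_apply, add_mul, mul_add, Finset.sum_add_distrib,
      ite_and]
    ring

theorem chiExp_orderedProd (m : Characteristic g) {X : Fin g → Fin g → Sp g}
    (hX : ∀ i j, X i j ∈ Gamma2 g) {l : List (Fin g × Fin g)} {P : Fin g → Fin g → Prop}
    [∀ i j, Decidable (P i j)] (hl : Enumerates l P) (k : Fin g → Fin g → ℤ) :
    (chiExp m (orderedProd l X k) : ZMod 4)
      = ∑ i, ∑ j, if P i j then (k i j : ZMod 4) * chiExp m (X i j) else 0 := by
  have h := congrArg Multiplicative.toAdd (map_orderedProd (chiHom m) hX hl.1 k)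
  have h1 : l.toFinset = Finset.univ.filter fun x => P x.1 x.2 := by
    ext x; simp [hl.2 x]
  rw [toAdd_prod, h1, Finset.sum_filter, Fintype.sum_prod_type] at h
  refine h.trans ?_
  refine Finset.sum_congr rfl fun i _ => Finset.sum_congr rfl fun j _ => ?_
  split_ifs
  · rw [toAdd_zpow, zsmul_eq_mul]; rfl
  · rfl

theorem chiExp_decomposition {lA lB lC : List (Fin g × Fin g)}
    (hA : Enumerates lA fun _ _ => True) (hB : Enumerates lB fun i j => i ≤ j)
    (hC : Enumerates lC fun i j => i ≤ j) (p q r : Fin g → Fin g → ℤ) {M' : Sp g}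
    (hM' : M' ∈ ⁅Gamma2 g, Gamma2 g⁆) (m : Characteristic g) :
    (chiExp m (orderedProd lA A p * orderedProd lB B q * orderedProd lC C r * M') : ZMod 4)
      = ((2 * expA p q r m - expB q r m : ℤ) : ZMod 4) := by
  have hMA := orderedProd_mem (g := g) A_mem_Gamma2 lA p
  have hMB := orderedProd_mem (g := g) B_mem_Gamma2 lB q
  have hMC := orderedProd_mem (g := g) C_mem_Gamma2 lC r
  have hM2 := mem_Gamma2_of_mem_commutator hM'
  have h0 : (chiExp m M' : ZMod 4) = 0 := map_eq_one_of_mem_commutator (chiHom m) hM2 hM'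
  rw [chiExp_mul m (mul_mem (mul_mem hMA hMB) hMC) hM2, chiExp_mul m (mul_mem hMA hMB) hMC,
    chiExp_mul m hMA hMB, h0, add_zero, chiExp_orderedProd m A_mem_Gamma2 hA,
    chiExp_orderedProd m B_mem_Gamma2 hB, chiExp_orderedProd m C_mem_Gamma2 hC]
  -- The diagonal sums become double sums, so that both sides can be compared index pair by index
  -- pair.
  have hdiag : ∀ F : Fin g → ZMod 4, ∑ i, F i = ∑ i, ∑ j, if i = j then F i else 0 := by
    intro F; simp
  rw [expA, expB]
  push_cast
  rw [hdiag (fun i => (q i i : ZMod 4) * m (Sum.inl i) ^ 2),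
    hdiag (fun i => (r i i : ZMod 4) * m (Sum.inr i) ^ 2)]
  simp only [mul_add, Finset.mul_sum, ← Finset.sum_add_distrib, ← Finset.sum_sub_distrib]
  refine Finset.sum_congr rfl fun i _ => Finset.sum_congr rfl fun j _ => ?_
  have h4 : (4 : ZMod 4) = 0 := rfl
  rw [chiExp_A, chiExp_B, chiExp_C]
  by_cases hij : i = j
  · subst hij
    simp
    ring
  · by_cases hle : i ≤ j
    · have hlt : i < j := lt_of_le_of_ne hle hij
      simp [hij, hle, hlt]
      linear_combination (-(r i j : ZMod 4) * m (Sum.inr i) * m (Sum.inr j)) * h4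
    · have hlt : ¬ i < j := fun h => hle h.le
      simp [hij, hle, hlt]
      ring

end Abelianization

/-! ### The theta multiplier and the values of `χ_m` -/

section CharacterValues

variable {g : ℕ}

theorem exp_pi_mul_I_congr {x y : ℂ} (k : ℤ) (h : x = y + 2 * k) :
    Complex.exp (Real.pi * Complex.I * x) = Complex.exp (Real.pi * Complex.I * y) := by
  rw [h, mul_add, Complex.exp_add, exp_pi_mul_I_mul_two_int, mul_one]

theorem IsThetaFactor.theta_of_mem_Gamma2 {M : Sp g} (hM : M ∈ Gamma2 g)
    {κ : Matrix (Fin g) (Fin g) ℂ → ℂ} (hκ : IsThetaFactor M κ) (m : Characteristic g)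
    {τ : Matrix (Fin g) (Fin g) ℂ} (hτ : τ ∈ SiegelUpperHalf g) (z : Fin g → ℂ) :
    SiegelTheta.theta m (act M τ) (((autFactor M τ)⁻¹)ᵀ *ᵥ z) =
      κ τ * expFactor M τ z * Complex.exp (Real.pi * Complex.I * (1 / 2 * (chiExp m M : ℂ)))
        * SiegelTheta.theta m τ z := by
  have h1 : (2 : ℂ) * chiExp m M = (quad m : ℂ) - quad (M.1ᵀ *ᵥ m)
      + 4 * (((m ∘ Sum.inl) ⬝ᵥ (halfDiff M m ∘ Sum.inr) : ℤ) : ℂ) := by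
    exact_mod_cast chiExp_eq hM m
  rw [hκ.theta m hτ z]
  conv_lhs => rw [transpose_mulVec_eq hM m, theta_add_two_smul, ← transpose_mulVec_eq hM m]
  rw [← mul_assoc, mul_assoc (κ τ * expFactor M τ z), ← Complex.exp_add, ← mul_add]
  congr 4
  linear_combination -(1 / 4 : ℂ) * h1

/-- The linear part of `M ∘ m`. -/
def charLinear (M : Sp g) (n : Characteristic g) : Characteristic g :=
  Sum.elim (blkD M *ᵥ (n ∘ Sum.inl) - blkC M *ᵥ (n ∘ Sum.inr))
    (-(blkB M *ᵥ (n ∘ Sum.inl)) + blkA M *ᵥ (n ∘ Sum.inr))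

/-- Half of the translation part of `M ∘ m`. -/
def charShift (M : Sp g) : Characteristic g :=
  Sum.elim (fun i => (blkC M * (blkD M)ᵀ).diag i / 2) (fun i => (blkA M * (blkB M)ᵀ).diag i / 2)

/-- On Γ_g(2) the blocks `b` and `c` are even, hence so is the translation part. -/
theorem charAct_eq {M : Sp g} (hM : M ∈ Gamma2 g) (n : Characteristic g) :
    charAct M n = charLinear M n + (2 : ℤ) • charShift M := by
  have h1 : ∀ i, (2 : ℤ) ∣ (blkC M * (blkD M)ᵀ).diag i := by
    intro i
    rw [diag_apply, mul_apply]
    refine Finset.dvd_sum fun k _ => Dvd.dvd.mul_right ?_ _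
    exact (even_offDiag hM (x := Sum.inr i) (y := Sum.inl k) (by simp)).two_dvd
  have h2 : ∀ i, (2 : ℤ) ∣ (blkA M * (blkB M)ᵀ).diag i := by
    intro i
    rw [diag_apply, mul_apply]
    refine Finset.dvd_sum fun k _ => Dvd.dvd.mul_left ?_ _
    exact (even_offDiag hM (x := Sum.inl i) (y := Sum.inr k) (by simp)).two_dvd
  ext (i | i)
  · simp only [charAct, charLinear, charShift, Sum.elim_inl, Pi.add_apply, Pi.smul_apply,
      smul_eq_mul, Int.mul_ediv_cancel' (h1 i)]
  · simp only [charAct, charLinear, charShift, Sum.elim_inr, Pi.add_apply, Pi.smul_apply,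
      smul_eq_mul, Int.mul_ediv_cancel' (h2 i)]

/-- The linear part of `M ∘ n` is the inverse of the map `ᵗM` occurring in `IsThetaFactor.theta`. -/
theorem transpose_mulVec_charLinear (M : Sp g) (n : Characteristic g) :
    M.1ᵀ *ᵥ charLinear M n = n := by
  obtain ⟨h1, h2, h3, h4⟩ := blk_relations M
  rw [coe_eq_fromBlocks M, fromBlocks_transpose, fromBlocks_mulVec, charLinear, Sum.elim_comp_inl,
    Sum.elim_comp_inr]
  ext (i | i)
  · rw [Sum.elim_inl]
    have : (blkA M)ᵀ *ᵥ (blkD M *ᵥ (n ∘ Sum.inl) - blkC M *ᵥ (n ∘ Sum.inr)) +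
        (blkC M)ᵀ *ᵥ (-(blkB M *ᵥ (n ∘ Sum.inl)) + blkA M *ᵥ (n ∘ Sum.inr)) = n ∘ Sum.inl := by
      simp only [mulVec_add, mulVec_sub, mulVec_neg, mulVec_mulVec, h1]
      have h := congrArg (· *ᵥ (n ∘ Sum.inl)) h3
      simp only [sub_mulVec, one_mulVec] at h
      refine Eq.trans ?_ h
      abel
    exact congrFun this i
  · rw [Sum.elim_inr]
    have : (blkB M)ᵀ *ᵥ (blkD M *ᵥ (n ∘ Sum.inl) - blkC M *ᵥ (n ∘ Sum.inr)) +
        (blkD M)ᵀ *ᵥ (-(blkB M *ᵥ (n ∘ Sum.inl)) + blkA M *ᵥ (n ∘ Sum.inr)) = n ∘ Sum.inr := by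
      simp only [mulVec_add, mulVec_sub, mulVec_neg, mulVec_mulVec, h2]
      have h := congrArg (· *ᵥ (n ∘ Sum.inr)) h4
      simp only [sub_mulVec, one_mulVec] at h
      refine Eq.trans ?_ h
      abel
    exact congrFun this i

/-- In this form Φ is directly comparable with the quarter difference of `quad` in
`IsThetaFactor.theta`. -/
theorem Phi_eq {M : Sp g} (hM : M ∈ Gamma2 g) (n : Characteristic g) :
    Phi n M = 1 / 8 * ((quad (charLinear M n) - quad n
      + 4 * ((charShift M ∘ Sum.inr) ⬝ᵥ (charLinear M n ∘ Sum.inl)) : ℤ) : ℂ) := by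
  have hs : (blkA M * (blkB M)ᵀ).diag = (2 : ℤ) • (charShift M ∘ Sum.inr) := by
    have h1 := congrArg (· ∘ Sum.inr) (charAct_eq hM 0)
    have h0 : ∀ s : Fin g → Fin g ⊕ Fin g, (0 : Characteristic g) ∘ s = 0 := fun _ => rfl
    have h2 : charAct M 0 ∘ Sum.inr = (blkA M * (blkB M)ᵀ).diag := by
      simp [charAct, h0]
    have h3 : charLinear M 0 = 0 := by
      ext (i | i) <;> simp [charLinear, h0]
    simp only [h2, h3, zero_add] at h1
    exact h1
  have hmul : ∀ (X Y : Matrix (Fin g) (Fin g) ℤ) (u v : Fin g → ℤ),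
      (X *ᵥ u) ⬝ᵥ (Y *ᵥ v) = u ⬝ᵥ ((Xᵀ * Y) *ᵥ v) := by
    intro X Y u v
    rw [← mulVec_mulVec, dotProduct_mulVec u, vecMul_transpose]
  obtain ⟨h1, h2, h3, h4⟩ := blk_relations M
  have h4' := congrArg (fun X => (n ∘ Sum.inl) ⬝ᵥ (X *ᵥ (n ∘ Sum.inr))) h4
  simp only [sub_mulVec, one_mulVec, dotProduct_sub] at h4'
  have h5 : quad (charLinear M n) = -((n ∘ Sum.inl) ⬝ᵥ (((blkB M)ᵀ * blkD M) *ᵥ (n ∘ Sum.inl)))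
      - (n ∘ Sum.inr) ⬝ᵥ (((blkA M)ᵀ * blkC M) *ᵥ (n ∘ Sum.inr))
      + 2 * ((n ∘ Sum.inl) ⬝ᵥ (((blkB M)ᵀ * blkC M) *ᵥ (n ∘ Sum.inr)))
      + (n ∘ Sum.inl) ⬝ᵥ (n ∘ Sum.inr) := by
    rw [quad, charLinear, Sum.elim_comp_inl, Sum.elim_comp_inr]
    simp only [sub_dotProduct, dotProduct_add, dotProduct_neg]
    rw [dotProduct_comm (blkC M *ᵥ _) (blkB M *ᵥ _), hmul, hmul, hmul, hmul, h1, h2]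
    linear_combination h4'
  rw [Phi, h5, hs, quad, smul_dotProduct, smul_eq_mul, charLinear, Sum.elim_comp_inl]
  push_cast
  ring

/-- Applied to M∘n, the general law lands on `n` plus an even vector; so κ satisfies the formula
that defines a(M) det(cτ+d)^{1/2}. -/
theorem IsThetaFactor.thetaConst_charAct {M : Sp g} (hM : M ∈ Gamma2 g)
    {κ : Matrix (Fin g) (Fin g) ℂ → ℂ} (hκ : IsThetaFactor M κ) (n : Characteristic g)
    {τ : Matrix (Fin g) (Fin g) ℂ} (hτ : τ ∈ SiegelUpperHalf g) :
    thetaConst (charAct M n) (act M τ) = κ τ * e (Phi n M) * thetaConst n τ := by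
  have h1 := hκ.theta (charAct M n) hτ 0
  rw [mulVec_zero, expFactor_zero, mul_one] at h1
  have h2 : M.1ᵀ *ᵥ charAct M n = n + (2 : ℤ) • (M.1ᵀ *ᵥ charShift M) := by
    rw [charAct_eq hM, mulVec_add, mulVec_smul, transpose_mulVec_charLinear]
  rw [thetaConst, thetaConst, h1]
  conv_lhs => rw [h2, theta_add_two_smul, ← h2]
  rw [← mul_assoc, mul_assoc (κ τ), ← Complex.exp_add, ← mul_add]
  congr 2
  have he : e (Phi n M) = Complex.exp (Real.pi * Complex.I * (2 * Phi n M)) := by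
    rw [e]; congr 1; ring
  rw [he, Phi_eq hM]
  -- `quad` is unchanged modulo 2 because M ≡ 1 mod 2; the resulting discrepancy `8k`, divided by 4,
  -- is an even multiple of πi.
  obtain ⟨k, hk⟩ : ∃ k : ℤ, quad (charShift M) - quad (M.1ᵀ *ᵥ charShift M) = 2 * k := by
    rw [transpose_mulVec_eq hM, quad_add, quad_smul, symp_smul_right]
    exact ⟨-(2 * quad (halfDiff M (charShift M)) + symp (charShift M) (halfDiff M (charShift M)) +
      (charShift M ∘ Sum.inr) ⬝ᵥ (((2 : ℤ) • halfDiff M (charShift M)) ∘ Sum.inl)), by ring⟩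
  refine exp_pi_mul_I_congr k ?_
  have hs := symp_transpose_mulVec M (charLinear M n) (charShift M)
  rw [transpose_mulVec_charLinear] at hs
  have hsm : ∀ u : Characteristic g, ((2 : ℤ) • u) ∘ (Sum.inl : Fin g → _) =
    (2 : ℤ) • (u ∘ Sum.inl) := fun _ => rfl
  have hint : quad (charAct M n) - quad (M.1ᵀ *ᵥ charAct M n)
      + 4 * ((n ∘ Sum.inl) ⬝ᵥ ((M.1ᵀ *ᵥ charShift M) ∘ Sum.inr))
      = quad (charLinear M n) - quad n
        + 4 * ((charShift M ∘ Sum.inr) ⬝ᵥ (charLinear M n ∘ Sum.inl)) + 8 * k := by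
    rw [h2, charAct_eq hM, quad_add, quad_add, quad_smul, quad_smul, symp_smul_right,
      symp_smul_right, hsm, hsm, dotProduct_smul, dotProduct_smul, smul_eq_mul, smul_eq_mul,
      dotProduct_comm (charShift M ∘ Sum.inr)]
    simp only [symp] at hs ⊢
    linear_combination 2 * hs + 4 * hk
  have hint' := congrArg (Int.cast (R := ℂ)) hint
  push_cast at hint' ⊢
  linear_combination (1 / 4 : ℂ) * hint'

/-- A square root `a` of the fourth root of unity ζ is an eighth root of unity, and κ/a squares to
det(cτ+d). -/
theorem IsThetaFactor.exists_multiplier {M : Sp g} (hM : M ∈ Gamma2 g)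
    {κ : Matrix (Fin g) (Fin g) ℂ → ℂ} (hκ : IsThetaFactor M κ) :
    ∃ (a : ℂ) (s : Matrix (Fin g) (Fin g) ℂ → ℂ), IsThetaMultiplier M a s ∧
      ∀ τ, a * s τ = κ τ := by
  obtain ⟨ζ, hζ, hs⟩ := hκ.sq_eq
  have hζ0 : ζ ≠ 0 := by rintro rfl; simp at hζ
  obtain ⟨a, ha⟩ := IsAlgClosed.exists_pow_nat_eq ζ (n := 2) two_pos
  have ha0 : a ≠ 0 := by rintro rfl; simp at ha; exact hζ0 ha.symm
  have has : ∀ τ, a * (κ τ / a) = κ τ := fun τ => mul_div_cancel₀ _ ha0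
  refine ⟨a, fun τ => κ τ / a, ⟨?_, hκ.continuousOn.div_const a, ?_, ?_⟩, has⟩
  · rw [show 8 = 2 * 4 from rfl, pow_mul, ha, hζ]
  · intro τ hτ
    rw [div_pow, hs τ hτ, ha, mul_div_cancel_left₀ _ hζ0]
  · intro n τ hτ
    rw [hκ.thetaConst_charAct hM n hτ]
    linear_combination -(e (Phi n M) * thetaConst n τ) * has τ

/-- Neither `a` nor `s` is canonical, but their product is, wherever some theta constant is nonzero.
-/
theorem IsThetaMultiplier.mul_eq {M : Sp g} (hM : M ∈ Gamma2 g) {a : ℂ}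
    {s κ : Matrix (Fin g) (Fin g) ℂ → ℂ} (h : IsThetaMultiplier M a s) (hκ : IsThetaFactor M κ)
    {n : Characteristic g} {τ : Matrix (Fin g) (Fin g) ℂ} (hτ : τ ∈ SiegelUpperHalf g)
    (hn : thetaConst n τ ≠ 0) : a * s τ = κ τ := by
  have h1 := h.transform n τ hτ
  rw [hκ.thetaConst_charAct hM n hτ] at h1
  have h2 := mul_right_cancel₀ hn h1
  have he : e (Phi n M) ≠ 0 := Complex.exp_ne_zero _
  apply mul_right_cancel₀ he
  linear_combination -h2

/-! #### Nonvanishing -/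

theorem exists_thetaConst_ne_zero {m : Characteristic g} (hm : IsEvenChar m) :
    ∃ τ ∈ SiegelUpperHalf g, thetaConst m τ ≠ 0 := by
  have hI : (Complex.I • (1 : Matrix (Fin g) (Fin g) ℂ)) ∈ SiegelUpperHalf g := by
    refine ⟨by simp, ?_⟩
    have : (Complex.I • (1 : Matrix (Fin g) (Fin g) ℂ)).map Complex.im = 1 := by
      ext i j; by_cases h : i = j <;> simp [h, one_apply]
    rw [this]
    exact PosDef.one
  -- With `t = ᵗv m''`, the real part of τ adds `t²` and the characteristic adds `t`. For even `m`
  -- the number `t` is an integer and `t(t+1)` is even, so each term is a positive real number.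
  let τ : Matrix (Fin g) (Fin g) ℂ := Complex.I • 1 + vecMulVec (sndV m) (sndV m)
  have hτ : τ ∈ SiegelUpperHalf g := by
    refine ⟨by simp [τ, transpose_vecMulVec], ?_⟩
    have : τ.map Complex.im = 1 := by
      ext i j
      by_cases h : i = j <;> simp [τ, h, one_apply, vecMulVec_apply, sndV, castV]
    rw [this]
    exact PosDef.one
  refine ⟨τ, hτ, ?_⟩
  let f : (Fin g → ℤ) → ℝ := fun p => Real.exp (-Real.pi * ∑ i, ((p i : ℝ) + m (Sum.inl i) / 2) ^ 2)
  have hf : Summable f := by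
    -- Completing the square exhibits `f` as a constant times the norms of theta terms at iI.
    have h1 := (summable_thetaTerm hI ((Complex.I / 2) • fstV m)).norm.mul_left
      (Real.exp (-Real.pi * ∑ i, ((m (Sum.inl i) : ℝ) / 2) ^ 2))
    refine h1.congr fun p => ?_
    rw [norm_thetaTerm, ← Real.exp_add]
    have hmap : (Complex.I • (1 : Matrix (Fin g) (Fin g) ℂ)).map Complex.im = 1 := by
      ext i j; by_cases h : i = j <;> simp [h, one_apply]
    rw [hmap, one_mulVec, ← mul_add]
    congr 2
    simp only [dotProduct, Finset.mul_sum, ← Finset.sum_add_distrib]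
    refine Finset.sum_congr rfl fun i _ => ?_
    simp [fstV, castV]
    ring
  have hterm : thetaConst m τ = ((∑' p, f p : ℝ) : ℂ) := by
    rw [Complex.ofReal_tsum, thetaConst, theta]
    congr 1
    ext p
    have hv : (fun i => (p i : ℂ) + (m (Sum.inl i) : ℂ) / 2) = castV p + (1 / 2 : ℂ) • fstV m := by
      ext i; simp [castV, fstV]; ring
    have hz : (fun i => (0 : Fin g → ℂ) i + (m (Sum.inr i) : ℂ) / 2) = (1 / 2 : ℂ) • sndV m := by
      ext i; simp [castV, sndV]; ring
    obtain ⟨r, hr⟩ := hm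
    obtain ⟨t, ht⟩ : ∃ t : ℤ, (castV p + (1 / 2 : ℂ) • fstV m) ⬝ᵥ sndV m = t := by
      refine ⟨p ⬝ᵥ (m ∘ Sum.inr) + r, ?_⟩
      rw [add_dotProduct, smul_dotProduct, fstV, sndV, dotProduct_castV, dotProduct_castV, hr]
      push_cast
      simp only [smul_eq_mul]
      ring
    have hsq : (castV p + (1 / 2 : ℂ) • fstV m) ⬝ᵥ (castV p + (1 / 2 : ℂ) • fstV m)
        = ((∑ i, ((p i : ℝ) + m (Sum.inl i) / 2) ^ 2 : ℝ) : ℂ) := by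
      rw [← hv]
      push_cast
      simp only [dotProduct]
      exact Finset.sum_congr rfl fun i _ => by ring
    simp only [hv, hz]
    have hvv : vecMulVec (sndV m) (sndV m) *ᵥ (castV p + (1 / 2 : ℂ) • fstV m)
        = (t : ℂ) • sndV m := by
      rw [vecMulVec_mulVec, dotProduct_comm, ht]
      ext i
      simp [mul_comm]
    rw [add_mulVec, hvv, smul_mulVec, one_mulVec, dotProduct_add, dotProduct_smul, dotProduct_smul,
      dotProduct_smul, ht, hsq]
    obtain ⟨k, hk⟩ : Even (t * (t + 1)) := Int.even_mul_succ_self t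
    have hk' : (t : ℂ) * (t + 1) = k + k := by exact_mod_cast congrArg (Int.cast (R := ℂ)) hk
    rw [exp_pi_mul_I_congr (y := Complex.I *
      ((∑ i, ((p i : ℝ) + m (Sum.inl i) / 2) ^ 2 : ℝ) : ℂ)) k (by
        simp only [smul_eq_mul]; linear_combination hk'), Complex.ofReal_exp]
    congr 1
    push_cast
    linear_combination (Real.pi * ∑ i, ((p i : ℂ) + m (Sum.inl i) / 2) ^ 2) * Complex.I_sq
  rw [hterm]
  exact Complex.ofReal_ne_zero.2
    (hf.tsum_pos (fun p => (Real.exp_pos _).le) 0 (Real.exp_pos _)).ne'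

/-- Translating back by the half period turns θ_m into a nonzero multiple of θ_0. The same τ must
serve both, since for odd `m` the relation `a * s τ = κ τ` is read off from θ_0. -/
theorem exists_theta_ne_zero (m : Characteristic g) :
    ∃ τ ∈ SiegelUpperHalf g, thetaConst 0 τ ≠ 0 ∧ ∃ z, theta m τ z ≠ 0 := by
  have h0 : IsEvenChar (0 : Characteristic g) := by
    refine ⟨0, ?_⟩
    simp [dotProduct]
  obtain ⟨τ, hτ, hne⟩ := exists_thetaConst_ne_zero h0
  refine ⟨τ, hτ, hne, -((1 / 2 : ℂ) • (τ *ᵥ fstV m + sndV m)), ?_⟩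
  rw [theta_eq_thetaZero m hτ.1, neg_add_cancel]
  refine mul_ne_zero (Complex.exp_ne_zero _) ?_
  rw [thetaConst, theta_eq_thetaZero 0 hτ.1] at hne
  have hf : fstV (0 : Characteristic g) = 0 := by ext i; simp [fstV, castV]
  have hs : sndV (0 : Characteristic g) = 0 := by ext i; simp [sndV, castV]
  simp only [hf, hs, mulVec_zero, add_zero, smul_zero] at hne
  exact right_ne_zero_of_mul hne

/-! #### The values of `χ_m` -/

/-- Existence comes from `a = √ζ`; uniqueness from cancelling κ, the exponential factor and θ_m at
one point of nonvanishing. -/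
theorem isCharValue_iff {M : Sp g} (hM : M ∈ Gamma2 g) (m : Characteristic g) (χ : ℂ) :
    IsCharValue m M χ ↔
      χ = Complex.exp (Real.pi * Complex.I * (1 / 2 * (chiExp m M : ℂ))) := by
  obtain ⟨κ, hκ⟩ := Gamma2_le_thetaGroup hM
  constructor
  · rintro ⟨a, s, has, h⟩
    obtain ⟨τ, hτ, h0, z, hz⟩ := exists_theta_ne_zero m
    have h1 := h τ hτ z
    have h2 := has.mul_eq hM hκ hτ h0
    rw [hκ.theta_of_mem_Gamma2 hM m hτ z] at h1
    have h3 := mul_right_cancel₀ hz h1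
    have he : expFactor M τ z ≠ 0 := Complex.exp_ne_zero _
    have h4 : a * χ * s τ * expFactor M τ z = κ τ * expFactor M τ z * χ := by rw [← h2]; ring
    have h5 := h3.trans h4
    exact (mul_left_cancel₀ (mul_ne_zero (hκ.ne_zero hτ) he) h5).symm
  · rintro rfl
    obtain ⟨a, s, has, h⟩ := hκ.exists_multiplier hM
    refine ⟨a, s, has, fun τ hτ z => ?_⟩
    rw [hκ.theta_of_mem_Gamma2 hM m hτ z, ← h τ, expFactor, autQuot]
    ring

theorem isConstCharValue_iff {M : Sp g} (hM : M ∈ Gamma2 g) {m : Characteristic g}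
    (hm : IsEvenChar m) (χ : ℂ) :
    IsConstCharValue m M χ ↔
      χ = Complex.exp (Real.pi * Complex.I * (1 / 2 * (chiExp m M : ℂ))) := by
  obtain ⟨κ, hκ⟩ := Gamma2_le_thetaGroup hM
  have key : ∀ τ ∈ SiegelUpperHalf g, thetaConst m (act M τ) =
      κ τ * Complex.exp (Real.pi * Complex.I * (1 / 2 * (chiExp m M : ℂ))) * thetaConst m τ := by
    intro τ hτ
    have h := hκ.theta_of_mem_Gamma2 hM m hτ 0
    rwa [mulVec_zero, expFactor_zero, mul_one] at h
  constructor
  · rintro ⟨a, s, has, h⟩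
    obtain ⟨τ, hτ, hne⟩ := exists_thetaConst_ne_zero hm
    have h1 := h τ hτ
    have h2 := has.mul_eq hM hκ hτ hne
    rw [key τ hτ] at h1
    have h3 := mul_right_cancel₀ hne h1
    have h4 : a * χ * s τ = κ τ * χ := by rw [← h2]; ring
    exact (mul_left_cancel₀ (hκ.ne_zero hτ) (h3.trans h4)).symm
  · rintro rfl
    obtain ⟨a, s, has, h⟩ := hκ.exists_multiplier hM
    refine ⟨a, s, has, fun τ hτ => ?_⟩
    rw [key τ hτ, ← h τ]
    ring

theorem exp_eq_neg_one_zpow_mul_e {c x y : ℤ} (h : (c : ZMod 4) = ((2 * x - y : ℤ) : ZMod 4)) :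
    Complex.exp (Real.pi * Complex.I * (1 / 2 * (c : ℂ))) = (-1 : ℂ) ^ x * e (-(y : ℂ) / 4) := by
  obtain ⟨k, hk⟩ := (ZMod.intCast_eq_intCast_iff_dvd_sub _ _ 4).1 h
  have hc : (c : ℂ) = 2 * x - y - 4 * k := by
    have : c = 2 * x - y - 4 * k := by push_cast at hk; linarith
    exact_mod_cast congrArg (Int.cast (R := ℂ)) this
  rw [← Complex.exp_pi_mul_I, ← Complex.exp_int_mul, e, ← Complex.exp_add,
    exp_pi_mul_I_congr (y := x - y / 2) (-k) (by rw [hc]; push_cast; ring)]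
  congr 1
  ring

end CharacterValues

end SiegelTheta

end

/-- The lists `lA`, `lB`, `lC` fix arbitrary orders in which the three products are taken. -/
theorem theorem3p4 (g : ℕ) (lA lB lC : List (Fin g × Fin g))
    (hA : SiegelTheta.Enumerates lA fun _ _ => True)
    (hB : SiegelTheta.Enumerates lB fun i j => i ≤ j)
    (hC : SiegelTheta.Enumerates lC fun i j => i ≤ j) :
    -- the commutator subgroup of `Γ_g(2)` lies in `Γ_g(4,8)`
    (∀ M' ∈ ⁅SiegelTheta.Gamma2 g, SiegelTheta.Gamma2 g⁆, M' ∈ SiegelTheta.Gamma48 g) ∧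
    -- every `M ∈ Γ_g(2)` can be written in the required form
    (∀ M ∈ SiegelTheta.Gamma2 g, ∃ p q r : Fin g → Fin g → ℤ,
      ∃ M' ∈ ⁅SiegelTheta.Gamma2 g, SiegelTheta.Gamma2 g⁆,
        M = SiegelTheta.orderedProd lA SiegelTheta.A p * SiegelTheta.orderedProd lB SiegelTheta.B q
          * SiegelTheta.orderedProd lC SiegelTheta.C r * M') ∧
    -- for every way of writing `M` in this form, `χ_m(M) = (-1)^A e(-B/4)`
    (∀ M ∈ SiegelTheta.Gamma2 g, ∀ p q r : Fin g → Fin g → ℤ,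
      ∀ M' ∈ ⁅SiegelTheta.Gamma2 g, SiegelTheta.Gamma2 g⁆,
        M = SiegelTheta.orderedProd lA SiegelTheta.A p * SiegelTheta.orderedProd lB SiegelTheta.B q
          * SiegelTheta.orderedProd lC SiegelTheta.C r * M' →
        ∀ m : SiegelTheta.Characteristic g,
          (∀ χ : ℂ, SiegelTheta.IsCharValue m M χ ↔
            χ = (-1 : ℂ) ^ SiegelTheta.expA p q r m
              * SiegelTheta.e (-(SiegelTheta.expB q r m : ℂ) / 4)) ∧
          (SiegelTheta.IsEvenChar m → ∀ χ : ℂ, SiegelTheta.IsConstCharValue m M χ ↔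
            χ = (-1 : ℂ) ^ SiegelTheta.expA p q r m
              * SiegelTheta.e (-(SiegelTheta.expB q r m : ℂ) / 4))) := by
  refine ⟨fun M' hM' => SiegelTheta.commutator_subset_Gamma48 hM',
    fun M hM => SiegelTheta.exists_decomposition hA hB hC hM, ?_⟩
  intro M hM p q r M' hM' hdec m
  have h := SiegelTheta.chiExp_decomposition hA hB hC p q r hM' m
  rw [← hdec] at h
  rw [← SiegelTheta.exp_eq_neg_one_zpow_mul_e h]
  exact ⟨SiegelTheta.isCharValue_iff hM m, fun hm => SiegelTheta.isConstCharValue_iff hM hm⟩
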